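/- **Theorem 2.6.** Let $\mathbb X\subseteq\mathbb R$ be an unbounded Borel set, and let $\Xi=(\xi_n)_{n\ge 0}$ be a time-homogeneous Markov chain on $\mathbb X$; write $\Pr_x,\mathbb E_x$ for probability and expectation when $\xi_0=x$. Put $\theta=\xi_1-\xi_0$, $\theta_+=\max(\theta,0)$, $\theta_-=\max(-\theta,0)$, $\mu(x)=\mathbb E_x[\theta]$, and $\tau_a=\min\{n\ge 0:|\xi_n|\le a\}$ (with $\min\emptyset=\infty$). Below, $x$ always ranges over $\mathbb X$. Suppose that the following two assumptions hold. (Heavier inward tails.) $\beta\in(1,2)$, $\alpha>\beta$, $c>0$ and $x_0\ge 0$ are constants such that $$\lim_{y\to\infty}\sup_{x\ge x_0}\bigl|y^\beta\Pr_x[\theta_->y]-c\bigr|=\lim_{y\to\infty}\sup_{x\le -x_0}\bigl|y^\beta\Pr_x[\theta_+>y]-c\bigr|=0,$$ $$\sup_{x\ge x_0}\mathbb E_x[\theta_+^\alpha]<\infty,\qquad \sup_{x\le -x_0}\mathbb E_x[\theta_-^\alpha]<\infty.$$ (Drift.) $\gamma\ge 0$ and $b\in\mathbb R$ are constants such that $$\lim_{x\to+\infty}x^\gamma\mu(x)=\lim_{x\to-\infty}\bigl(-|x|^\gamma\mu(x)\bigr)=b.$$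 Let $q>0$. Then for all $a$ sufficiently large and all $x\in\mathbb X$ with $x>a$, the following hold. (i) If $\gamma>\beta-1>1/2$, then $\mathbb E_x[\tau_a^q]<\infty$ for $q<\frac{2\beta-3}{\beta}$, and $\mathbb E_x[\tau_a^q]=\infty$ for $q>\frac{2\beta-3}{\beta}$. (ii) If $\gamma=\beta-1$ and $b+c\pi\cot(\pi\beta)<0$, then the equation $$\frac bc=\Gamma(\nu)\left(\frac{(1-\beta+\nu)\Gamma(1-\beta)}{\Gamma(2-\beta+\nu)}-\frac{\Gamma(\beta-\nu)}{\Gamma(\beta)}\right)$$ has a unique solution $\nu^\star=\nu^\star(\beta,b,c)$ in $(0,\beta)$; and $\mathbb E_x[\tau_a^q]<\infty$ for $q<\nu^\star/\beta$, and $\mathbb E_x[\tau_a^q]=\infty$ for $q>\nu^\star/\beta$. (iii) If $\gamma<\beta-1$ and $b<0$, then $\mathbb E_x[\tau_a^q]<\infty$ for $q<\frac{\beta}{\gamma+1}$, and $\mathbb E_x[\tau_a^q]=\infty$ for $q\ge\frac{\beta}{\gamma+1}$. -/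

import Mathlib

open MeasureTheory ProbabilityTheory Filter Topology Set
open scoped ENNReal

noncomputable section

namespace HeavyTailChain

variable {X : Set ℝ}

/-- The step-`n` kernel of the time-homogeneous Markov chain with transition kernel `P`: given the
history `(ξ₀, …, ξₙ)`, the state `ξₙ₊₁` has law `P ξₙ`. -/
def stepKernel (P : Kernel X X) (n : ℕ) : Kernel (Finset.Iic n → X) X :=
  P.comap (fun h => h ⟨n, Finset.mem_Iic.2 le_rfl⟩) (measurable_pi_apply _)

/-- `pathLaw P x` is the law, on the path space `ℕ → X`, of the time-homogeneous Markov chain with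
transition kernel `P` started from `ξ₀ = x` (Ionescu-Tulcea). -/
def pathLaw (P : Kernel X X) [IsMarkovKernel P] (x : X) : Measure (ℕ → X) :=
  haveI : ∀ n, IsMarkovKernel (stepKernel P n) := fun n => by
    unfold stepKernel; infer_instance
  Kernel.traj (X := fun _ => X) (stepKernel P) 0 (fun _ => x)

/-- `τ_a = min {n : |ξₙ| ≤ a}`, equal to `⊤` if the path never enters `[-a, a]`. -/
def passageTime (a : ℝ) (ξ : ℕ → X) : ℕ∞ :=
  ⨅ (n : ℕ) (_ : |(ξ n : ℝ)| ≤ a), (n : ℕ∞)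

/-- `E_x[τ_a ^ q]`, with value in `[0, ∞]`. -/
def passageMoment (P : Kernel X X) [IsMarkovKernel P] (q a : ℝ) (x : X) : ℝ≥0∞ :=
  ∫⁻ ξ, ((passageTime a ξ : ℕ∞) : ℝ≥0∞) ^ q ∂(pathLaw P x)

/-- The mean drift `μ(x) = E_x[θ]`, where `θ = ξ₁ - ξ₀`. -/
def drift (P : Kernel X X) (x : X) : ℝ := ∫ z : X, ((z : ℝ) - x) ∂(P x)

/-- `P_x[θ₊ > y]`. -/
def tailPos (P : Kernel X X) (x : X) (y : ℝ) : ℝ := (P x).real {z : X | y < ((z : ℝ) - x)⁺}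

/-- `P_x[θ₋ > y]`. -/
def tailNeg (P : Kernel X X) (x : X) (y : ℝ) : ℝ := (P x).real {z : X | y < ((z : ℝ) - x)⁻}

/-- `E_x[θ₊ ^ p]`, with value in `[0, ∞]`. -/
def momentPos (P : Kernel X X) (p : ℝ) (x : X) : ℝ≥0∞ :=
  ∫⁻ z : X, ENNReal.ofReal (((z : ℝ) - x)⁺ ^ p) ∂(P x)

/-- `E_x[θ₋ ^ p]`, with value in `[0, ∞]`. -/
def momentNeg (P : Kernel X X) (p : ℝ) (x : X) : ℝ≥0∞ :=
  ∫⁻ z : X, ENNReal.ofReal (((z : ℝ) - x)⁻ ^ p) ∂(P x)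

/-- Heavier inward tails. The suprema run over the points `x` of the state space `X`, and are taken
in `[0, ∞]`. -/
structure InwardTails (P : Kernel X X) (α β c x₀ : ℝ) : Prop where
  one_lt_beta : 1 < β
  beta_lt_two : β < 2
  beta_lt_alpha : β < α
  c_pos : 0 < c
  x₀_nonneg : 0 ≤ x₀
  tail_right : Tendsto
    (fun y : ℝ => ⨆ (x : X) (_ : x₀ ≤ (x : ℝ)), ENNReal.ofReal |y ^ β * tailNeg P x y - c|)
    atTop (𝓝 0)
  tail_left : Tendsto
    (fun y : ℝ => ⨆ (x : X) (_ : (x : ℝ) ≤ -x₀), ENNReal.ofReal |y ^ β * tailPos P x y - c|)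
    atTop (𝓝 0)
  moment_right : (⨆ (x : X) (_ : x₀ ≤ (x : ℝ)), momentPos P α x) < ⊤
  moment_left : (⨆ (x : X) (_ : (x : ℝ) ≤ -x₀), momentNeg P α x) < ⊤

/-- Asymptotic form of the drift: `x ^ γ μ(x) → b` as `x → +∞` and `-|x| ^ γ μ(x) → b` as
`x → -∞`, with `x` running through the state space `X`. -/
structure DriftAsymptotics (P : Kernel X X) (γ b : ℝ) : Prop where
  gamma_nonneg : 0 ≤ γ
  right : Tendsto (fun x : X => (x : ℝ) ^ γ * drift P x) (comap (fun x : X => (x : ℝ)) atTop) (𝓝 b)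
  left : Tendsto (fun x : X => -|(x : ℝ)| ^ γ * drift P x)
    (comap (fun x : X => (x : ℝ)) atBot) (𝓝 b)

/-- The equation for the critical exponent `ν`. -/
def CriticalEq (β b c ν : ℝ) : Prop :=
  b / c = Real.Gamma ν * ((1 - β + ν) * Real.Gamma (1 - β) / Real.Gamma (2 - β + ν)
    - Real.Gamma (β - ν) / Real.Gamma β)

end HeavyTailChain

end

namespace HeavyTailChain

variable {X : Set ℝ}

/-! The proof measures the chain by the Lyapunov functions `|x| ^ r` with `0 < r < β`. Let `w` be
the inward component of a jump from a point at distance `x` from the origin, and put `h(v) = |1 - v|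
^ r - 1 + r v`. Then `|x - w| ^ r - x ^ r = -r x ^ (r-1) w + x ^ r h(w/x)`. The linear term sees
only the mean drift. For inward jumps, Fubini turns the mean of `h(w/x)` into an integral of the
tail against `r * stepProfile r`, and the tail `c y ^ (-β)` makes it asymptotic to `c r tailDrift β
r x ^ (-β)`. Outward jumps contribute only `O(x ^ (-min α 2))`, which is smaller since `β < min α
2`. So the increment of `|x| ^ r` is `r |x| ^ (r-1)` times the outward drift, plus `c r tailDrift β
r |x| ^ (r-β)`, up to `o(|x| ^ (r-β))` (`InwardTails.tendsto_powerDrift_sub`).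

If `γ = β - 1`, both terms have the same order and the sign of the increment is that of `b + c *
tailDrift β r`. The function `tailDrift β` increases strictly on `(0, β)` from `π cot (π β)` to
infinity, so there is exactly one root `ν`, and the critical equation is this root condition in
terms of Gamma functions. If `γ > β - 1`, the drift is negligible, so `b = 0` there, and the root is
`2 β - 3`. Below the root, `|x| ^ (β p)` loses at least a multiple of `(|x| ^ β) ^ (p-1)` per step,
which bounds moments of order below `p`. Above the root, `|x| ^ s` is a submartingale until passage,
while `|x| ^ r` with `r` near `β` grows at most linearly in mean; survival then cannot decay fast
enough for a finite moment (`passageMoment_eq_top_of_submartingale`).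

If `γ < β - 1` and `b < 0`, the drift dominates and `|x| ^ (γ+1)` decreases at a roughly constant
rate, so passage from distance `L` takes time of order `L ^ (γ+1)`. Powers `|x| ^ r` with `r < β`
give the finite moments. Conversely, a first jump to distance `L` has probability at least a
multiple of `L ^ (-β)`, so survival beyond `n` is at least of order `n ^ (-β/(γ+1))`. A finite
moment of order `q` would force `n ^ q P[τ > n] → 0`, which excludes even the endpoint `q =
β/(γ+1)`. -/

instance (P : Kernel X X) [IsMarkovKernel P] (n : ℕ) : IsMarkovKernel (stepKernel P n) := by
  unfold stepKernel; infer_instance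

/-! ### The transition operator killed in `[-a, a]` -/

/-- The transition operator of the chain killed on entering `[-a, a]`. -/
noncomputable def killed (P : Kernel X X) (a : ℝ) (g : X → ℝ≥0∞) (x : X) : ℝ≥0∞ :=
  ∫⁻ z, {z : X | a < |(z : ℝ)|}.indicator g z ∂(P x)

lemma measurableSet_abs_gt (a : ℝ) : MeasurableSet {z : X | a < |(z : ℝ)|} :=
  measurableSet_lt measurable_const (by fun_prop)

@[fun_prop]
lemma measurable_killed (P : Kernel X X) (a : ℝ) {g : X → ℝ≥0∞} (hg : Measurable g) :
    Measurable (killed P a g) :=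
  (hg.indicator (measurableSet_abs_gt a)).lintegral_kernel

@[fun_prop]
lemma measurable_killed_iterate (P : Kernel X X) (a : ℝ) (n : ℕ) {g : X → ℝ≥0∞}
    (hg : Measurable g) : Measurable ((killed P a)^[n] g) := by
  induction n generalizing g with
  | zero => simpa
  | succ n ih => exact ih (measurable_killed P a hg)

lemma killed_mono (P : Kernel X X) (a : ℝ) {f g : X → ℝ≥0∞}
    (h : ∀ x : X, a < |(x : ℝ)| → f x ≤ g x) (x : X) : killed P a f x ≤ killed P a g x :=
  lintegral_mono fun z => indicator_le_indicator' (h z)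

lemma killed_add (P : Kernel X X) (a : ℝ) {f g : X → ℝ≥0∞} (hf : Measurable f) (x : X) :
    killed P a (fun z => f z + g z) x = killed P a f x + killed P a g x := by
  unfold killed
  rw [← lintegral_add_left (hf.indicator (measurableSet_abs_gt a))]
  refine lintegral_congr fun z => ?_
  by_cases h : z ∈ {z : X | a < |(z : ℝ)|} <;> simp [h]

lemma killed_const_mul (P : Kernel X X) (a : ℝ) (C : ℝ≥0∞) {f : X → ℝ≥0∞} (hf : Measurable f)
    (x : X) : killed P a (fun z => C * f z) x = C * killed P a f x := by
  unfold killed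
  rw [← lintegral_const_mul _ (hf.indicator (measurableSet_abs_gt a))]
  refine lintegral_congr fun z => ?_
  by_cases h : z ∈ {z : X | a < |(z : ℝ)|} <;> simp [h]

lemma killed_one_le (P : Kernel X X) [IsMarkovKernel P] (a : ℝ) (x : X) :
    killed P a (fun _ => 1) x ≤ 1 := by
  calc killed P a (fun _ => 1) x ≤ ∫⁻ _, 1 ∂(P x) :=
        lintegral_mono fun z => indicator_le_self' (by simp) z
    _ = 1 := by simp

/-- The killed operator never evaluates its argument inside `[-a, a]`. Hence all Lyapunov
inequalities below are needed only at points outside. -/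
lemma killed_iterate_mono (P : Kernel X X) (a : ℝ) (n : ℕ) {f g : X → ℝ≥0∞}
    (h : ∀ x : X, a < |(x : ℝ)| → f x ≤ g x) {x : X} (hx : a < |(x : ℝ)|) :
    (killed P a)^[n] f x ≤ (killed P a)^[n] g x := by
  induction n generalizing x with
  | zero => exact h x hx
  | succ n ih =>
    rw [Function.iterate_succ_apply', Function.iterate_succ_apply']
    exact killed_mono P a (fun z hz => ih hz) x

lemma killed_iterate_add (P : Kernel X X) (a : ℝ) (n : ℕ) {f g : X → ℝ≥0∞} (hf : Measurable f)
    (x : X) : (killed P a)^[n] (fun z => f z + g z) x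
      = (killed P a)^[n] f x + (killed P a)^[n] g x := by
  induction n generalizing x with
  | zero => rfl
  | succ n ih =>
    simp only [Function.iterate_succ_apply']
    rw [← killed_add P a (measurable_killed_iterate P a n hf)]
    congr 1
    exact funext ih

lemma killed_iterate_const_mul (P : Kernel X X) (a : ℝ) (n : ℕ) (C : ℝ≥0∞) {f : X → ℝ≥0∞}
    (hf : Measurable f) (x : X) :
    (killed P a)^[n] (fun z => C * f z) x = C * (killed P a)^[n] f x := by
  induction n generalizing x with
  | zero => rfl
  | succ n ih =>
    simp only [Function.iterate_succ_apply']
    rw [← killed_const_mul P a C (measurable_killed_iterate P a n hf)]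
    congr 1
    exact funext ih

/-! ### From path space to iterates of the killed operator -/

/-- The Markov property of the path law. -/
lemma lintegral_pathLaw_mul_succ (P : Kernel X X) [IsMarkovKernel P] (x : X) (n : ℕ)
    {F : (Finset.Iic n → X) → ℝ≥0∞} (hF : Measurable F) {g : X → ℝ≥0∞} (hg : Measurable g) :
    ∫⁻ ξ, F (Preorder.frestrictLe n ξ) * g (ξ (n + 1)) ∂(pathLaw P x)
      = ∫⁻ ξ, F (Preorder.frestrictLe n ξ) * ∫⁻ z, g z ∂(P (ξ n)) ∂(pathLaw P x) := by
  -- The joint law of the history up to `n` and the next state is the law of the history followed by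
  -- the step kernel.
  have hmap := Kernel.partialTraj_compProd_eq_map_traj (X := fun _ : ℕ => X) (κ := stepKernel P)
    (Nat.zero_le n) (x₀ := fun _ => x)
  have hgk : Measurable fun y => ∫⁻ z, g z ∂(P y) := hg.lintegral_kernel
  have hm : Measurable fun h : Finset.Iic n → X => h ⟨n, Finset.mem_Iic.2 le_rfl⟩ :=
    measurable_pi_apply _
  calc ∫⁻ ξ, F (Preorder.frestrictLe n ξ) * g (ξ (n + 1)) ∂(pathLaw P x)
      = ∫⁻ p : (Finset.Iic n → X) × X, F p.1 * g p.2
          ∂((pathLaw P x).map fun ξ => (Preorder.frestrictLe n ξ, ξ (n + 1))) := by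
        rw [lintegral_map (by fun_prop) (by fun_prop)]
    _ = ∫⁻ h, F h * ∫⁻ z, g z ∂(P (h ⟨n, Finset.mem_Iic.2 le_rfl⟩))
          ∂(Kernel.partialTraj (X := fun _ => X) (stepKernel P) 0 n fun _ => x) := by
        rw [pathLaw, ← hmap, Measure.lintegral_compProd (by fun_prop)]
        refine lintegral_congr fun h => ?_
        rw [stepKernel, Kernel.comap_apply]
        exact lintegral_const_mul (F h) (f := g) hg
    _ = _ := by
        rw [← Kernel.traj_map_frestrictLe, Kernel.map_apply _ (by fun_prop),
          lintegral_map (by fun_prop) (by fun_prop)]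
        rfl

lemma lintegral_pathLaw_zero (P : Kernel X X) [IsMarkovKernel P] (x : X)
    {g : X → ℝ≥0∞} (hg : Measurable g) : ∫⁻ ξ, g (ξ 0) ∂(pathLaw P x) = g x := by
  have h := Kernel.traj_map_frestrictLe_apply (X := fun _ : ℕ => X) (κ := stepKernel P) 0 0
    (fun _ => x)
  rw [Kernel.partialTraj_self, Kernel.id_apply] at h
  have hm : Measurable fun h : Finset.Iic 0 → X => g (h ⟨0, Finset.mem_Iic.2 le_rfl⟩) := by
    fun_prop
  calc ∫⁻ ξ, g (ξ 0) ∂(pathLaw P x)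
      = ∫⁻ h, g (h ⟨0, Finset.mem_Iic.2 le_rfl⟩)
          ∂((pathLaw P x).map (Preorder.frestrictLe (π := fun _ => X) 0)) := by
        rw [lintegral_map hm (by fun_prop)]; rfl
    _ = g x := by
        rw [pathLaw, h, lintegral_dirac' _ hm]

/-- The event that the path avoids `[-a, a]` up to time `n`. -/
def avoids (X : Set ℝ) (a : ℝ) (n : ℕ) : Set (ℕ → X) := {ξ | ∀ k ≤ n, a < |(ξ k : ℝ)|}

lemma measurableSet_avoids (a : ℝ) (n : ℕ) : MeasurableSet (avoids X a n) := by
  have : avoids X a n = ⋂ k, ⋂ (_ : k ≤ n), {ξ : ℕ → X | a < |(ξ k : ℝ)|} := by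
    ext; simp [avoids]
  rw [this]
  exact MeasurableSet.iInter fun k => MeasurableSet.iInter fun _ =>
    measurableSet_lt measurable_const (by fun_prop)

lemma lt_passageTime_iff (a : ℝ) (n : ℕ) (ξ : ℕ → X) :
    (n : ℕ∞) < passageTime a ξ ↔ ξ ∈ avoids X a n := by
  rw [← not_iff_not, not_lt]
  simp only [avoids, mem_ofPred_eq, not_forall, not_lt, exists_prop]
  constructor
  · intro h
    by_contra hne
    push Not at hne
    have : ((n + 1 : ℕ) : ℕ∞) ≤ passageTime a ξ := by
      refine le_iInf₂ fun k hk => ?_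
      by_contra hlt
      push Not at hlt
      exact absurd hk (not_le.2 (hne k (Nat.lt_succ_iff.1 (by exact_mod_cast hlt))))
    have h2 := this.trans h
    exact absurd (by exact_mod_cast h2 : n + 1 ≤ n) (by omega)
  · rintro ⟨k, hk, h⟩
    exact (iInf₂_le k h).trans (by exact_mod_cast hk)

/-- Bridge from paths to operators: afterwards only iterates of `killed` matter. The Markov property
absorbs the last step of the path into the test function, so the induction must vary `g`. -/
lemma lintegral_avoids (P : Kernel X X) [IsMarkovKernel P] {a : ℝ} {x : X} (hx : a < |(x : ℝ)|)
    (n : ℕ) {g : X → ℝ≥0∞} (hg : Measurable g) :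
    ∫⁻ ξ, (avoids X a n).indicator (fun ξ => g (ξ n)) ξ ∂(pathLaw P x)
      = (killed P a)^[n] g x := by
  induction n generalizing g with
  | zero =>
    have : ∀ ξ : ℕ → X, (avoids X a 0).indicator (fun ξ => g (ξ 0)) ξ
        = {z : X | a < |(z : ℝ)|}.indicator g (ξ 0) := by
      intro ξ
      by_cases h : a < |(ξ 0 : ℝ)| <;> simp [avoids, indicator, h]
    simp_rw [this]
    rw [lintegral_pathLaw_zero P x (hg.indicator (measurableSet_abs_gt a))]
    simp [hx]
  | succ n ih =>
    rw [Function.iterate_succ_apply, ← ih (measurable_killed P a hg)]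
    have hg' := hg.indicator (measurableSet_abs_gt (X := X) a)
    let A : Set (Finset.Iic n → X) := {h | ∀ k, a < |(h k : ℝ)|}
    have hA : MeasurableSet A := by
      have : A = ⋂ k, {h : Finset.Iic n → X | a < |(h k : ℝ)|} := by ext; simp [A]
      rw [this]
      exact MeasurableSet.iInter fun k => measurableSet_lt measurable_const (by fun_prop)
    have hmem : ∀ ξ : ℕ → X, Preorder.frestrictLe n ξ ∈ A ↔ ξ ∈ avoids X a n := by
      intro ξ
      simp [A, avoids, Preorder.frestrictLe]
    have h := lintegral_pathLaw_mul_succ P x n (F := A.indicator fun _ => 1)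
      (measurable_const.indicator hA) hg'
    calc _ = ∫⁻ ξ, A.indicator (fun _ => 1) (Preorder.frestrictLe n ξ)
            * {z : X | a < |(z : ℝ)|}.indicator g (ξ (n + 1)) ∂(pathLaw P x) := by
          refine lintegral_congr fun ξ => ?_
          have hs : ξ ∈ avoids X a (n + 1) ↔ ξ ∈ avoids X a n ∧ a < |(ξ (n + 1) : ℝ)| := by
            simp only [avoids, mem_ofPred_eq]
            constructor
            · exact fun h => ⟨fun k hk => h k (by omega), h _ le_rfl⟩
            · rintro ⟨h1, h2⟩ k hk
              rcases Nat.le_succ_iff.1 hk with h | rfl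
              exacts [h1 k h, h2]
          by_cases h1 : ξ ∈ avoids X a n <;> by_cases h2 : a < |(ξ (n + 1) : ℝ)| <;>
            simp [indicator, hs, hmem, h1, h2]
      _ = _ := by
          rw [h]
          refine lintegral_congr fun ξ => ?_
          by_cases h1 : ξ ∈ avoids X a n <;> simp [indicator, hmem, h1, killed]

/-- `P_x[τ_a > n]`. -/
lemma pathLaw_avoids (P : Kernel X X) [IsMarkovKernel P] {a : ℝ} {x : X} (hx : a < |(x : ℝ)|)
    (n : ℕ) : pathLaw P x (avoids X a n) = (killed P a)^[n] (fun _ => 1) x := by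
  rw [← lintegral_avoids P hx n measurable_const, lintegral_indicator (measurableSet_avoids a n)]
  simp

lemma killed_iterate_one_le (P : Kernel X X) [IsMarkovKernel P] (a : ℝ) (n : ℕ) {x : X}
    (hx : a < |(x : ℝ)|) : (killed P a)^[n] (fun _ => 1) x ≤ 1 := by
  induction n with
  | zero => simp
  | succ n ih =>
    rw [Function.iterate_succ_apply]
    exact (killed_iterate_mono P a n (fun z _ => killed_one_le P a z) hx).trans ih

/-! ### Telescoped one-step inequalities -/

/-- Discrete Dynkin inequality: the loss `g` is collected at every step spent outside `[-a, a]`. The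
variants below allow a gain, or bound the loss from the other side. -/
lemma killed_iterate_add_sum_le (P : Kernel X X) {a : ℝ} {f g : X → ℝ≥0∞} (hf : Measurable f)
    (h : ∀ x : X, a < |(x : ℝ)| → killed P a f x + g x ≤ f x) {x : X} (hx : a < |(x : ℝ)|)
    (n : ℕ) :
    (killed P a)^[n] f x + ∑ k ∈ Finset.range n, (killed P a)^[k] g x ≤ f x := by
  induction n with
  | zero => simp
  | succ n ih =>
    refine le_trans ?_ ih
    rw [Finset.sum_range_succ, ← add_assoc, add_right_comm, Function.iterate_succ_apply,
      ← killed_iterate_add P a n (measurable_killed P a hf)]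
    gcongr
    exact killed_iterate_mono P a n h hx

lemma tsum_killed_iterate_le (P : Kernel X X) {a : ℝ} {f g : X → ℝ≥0∞} (hf : Measurable f)
    (h : ∀ x : X, a < |(x : ℝ)| → killed P a f x + g x ≤ f x) {x : X} (hx : a < |(x : ℝ)|) :
    ∑' k, (killed P a)^[k] g x ≤ f x := by
  rw [ENNReal.tsum_eq_iSup_nat]
  exact iSup_le fun n => le_add_self.trans (killed_iterate_add_sum_le P hf h hx n)

lemma killed_iterate_le (P : Kernel X X) {a : ℝ} {f : X → ℝ≥0∞} (hf : Measurable f)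
    (h : ∀ x : X, a < |(x : ℝ)| → killed P a f x ≤ f x) {x : X} (hx : a < |(x : ℝ)|)
    (n : ℕ) : (killed P a)^[n] f x ≤ f x :=
  le_self_add.trans
    (killed_iterate_add_sum_le P (g := fun _ => 0) hf (fun x hx => by simpa using h x hx) hx n)

lemma killed_iterate_le_add_sum (P : Kernel X X) {a : ℝ} {f g : X → ℝ≥0∞} (hf : Measurable f)
    (h : ∀ x : X, a < |(x : ℝ)| → killed P a f x ≤ f x + g x) {x : X} (hx : a < |(x : ℝ)|)
    (n : ℕ) :
    (killed P a)^[n] f x ≤ f x + ∑ k ∈ Finset.range n, (killed P a)^[k] g x := by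
  induction n with
  | zero => simp
  | succ n ih =>
    rw [Finset.sum_range_succ, ← add_assoc, Function.iterate_succ_apply]
    refine (killed_iterate_mono P a n h hx).trans ?_
    rw [killed_iterate_add P a n hf]
    gcongr

lemma le_killed_iterate_add_sum (P : Kernel X X) {a : ℝ} {f g : X → ℝ≥0∞} (hf : Measurable f)
    (h : ∀ x : X, a < |(x : ℝ)| → f x ≤ killed P a f x + g x) {x : X} (hx : a < |(x : ℝ)|)
    (n : ℕ) :
    f x ≤ (killed P a)^[n] f x + ∑ k ∈ Finset.range n, (killed P a)^[k] g x := by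
  induction n with
  | zero => simp
  | succ n ih =>
    refine ih.trans ?_
    rw [Finset.sum_range_succ, ← add_assoc, add_right_comm, Function.iterate_succ_apply,
      ← killed_iterate_add P a n (measurable_killed P a hf)]
    gcongr
    exact killed_iterate_mono P a n h hx

/-! ### Passage-time moments and survival probabilities -/

lemma rpow_le_of_forall_nat {q : ℝ} (hq : 0 < q) {F : ℕ∞ → ℝ≥0∞} (hF : Monotone F)
    (h : ∀ N : ℕ, (N : ℝ≥0∞) ^ q ≤ F N) (t : ℕ∞) : (t : ℝ≥0∞) ^ q ≤ F t := by
  induction t using ENat.recTopCoe with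
  | coe N => simpa using h N
  | top =>
    have h1 : Tendsto (fun N : ℕ => (N : ℝ≥0∞) ^ q) atTop (𝓝 ⊤) := by
      have := (ENNReal.continuous_rpow_const (y := q)).tendsto ⊤
      rw [ENNReal.top_rpow_of_pos hq] at this
      exact this.comp ENNReal.tendsto_nat_nhds_top
    have h2 : (⊤ : ℝ≥0∞) ≤ F ⊤ :=
      le_of_tendsto h1 (Eventually.of_forall fun N => (h N).trans (hF le_top))
    simp [top_le_iff.1 h2]

lemma natCast_rpow_eq_ofReal {q : ℝ} (hq : 0 ≤ q) (N : ℕ) :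
    (N : ℝ≥0∞) ^ q = ENNReal.ofReal ((N : ℝ) ^ q) := by
  rw [← ENNReal.ofReal_natCast, ENNReal.ofReal_rpow_of_nonneg (by positivity) hq]

/-- For finite `t = N` there are `N` nonzero terms, each at least `N ^ (q - 1)` because the exponent
is nonpositive. -/
lemma enat_rpow_le_tsum {q : ℝ} (hq : 0 < q) (hq1 : q ≤ 1) (t : ℕ∞) :
    (t : ℝ≥0∞) ^ q
      ≤ ∑' k : ℕ, ENNReal.ofReal (((k : ℝ) + 1) ^ (q - 1)) * if (k : ℕ∞) < t then 1 else 0 := by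
  refine rpow_le_of_forall_nat hq (F := fun t => ∑' k : ℕ,
    ENNReal.ofReal (((k : ℝ) + 1) ^ (q - 1)) * if (k : ℕ∞) < t then 1 else 0) ?_ ?_ t
  · intro s t hst
    refine ENNReal.tsum_le_tsum fun k => ?_
    gcongr
    by_cases h : (k : ℕ∞) < s
    · simp [h, h.trans_le hst]
    · simp [h]
  · intro N
    rcases Nat.eq_zero_or_pos N with rfl | hN
    · simp [hq]
    have hN' : (0 : ℝ) < N := by exact_mod_cast hN
    refine le_trans ?_ (ENNReal.sum_le_tsum (Finset.range N))
    calc (N : ℝ≥0∞) ^ q = ∑ k ∈ Finset.range N, ENNReal.ofReal ((N : ℝ) ^ (q - 1)) := by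
          rw [natCast_rpow_eq_ofReal hq.le, Finset.sum_const, Finset.card_range, nsmul_eq_mul,
            ← ENNReal.ofReal_natCast, ← ENNReal.ofReal_mul hN'.le]
          congr 1
          nth_rw 2 [← Real.rpow_one (N : ℝ)]
          rw [← Real.rpow_add hN']
          ring_nf
      _ ≤ _ := by
          refine Finset.sum_le_sum fun k hk => ?_
          have hk' := Finset.mem_range.1 hk
          rw [if_pos (by exact_mod_cast hk'), mul_one]
          refine ENNReal.ofReal_le_ofReal
            (Real.rpow_le_rpow_of_nonpos (by positivity) ?_ (by linarith))
          exact_mod_cast hk'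

/-- About `N ^ 2 / 2` pairs satisfy `j + k < N`, each with weight at least `N ^ (q - 2)`. The double
sum is used because its inner sum becomes the expected remaining survival time after `j`, which a
linear Lyapunov function controls. -/
lemma enat_rpow_le_tsum_tsum {q : ℝ} (hq : 1 ≤ q) (hq2 : q ≤ 2) (t : ℕ∞) :
    (t : ℝ≥0∞) ^ q
      ≤ 2 * ∑' j : ℕ, ENNReal.ofReal (((j : ℝ) + 1) ^ (q - 2))
        * ∑' k : ℕ, if ((j + k : ℕ) : ℕ∞) < t then 1 else 0 := by
  refine rpow_le_of_forall_nat (by linarith) (F := fun t =>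
    2 * ∑' j : ℕ, ENNReal.ofReal (((j : ℝ) + 1) ^ (q - 2))
        * ∑' k : ℕ, if ((j + k : ℕ) : ℕ∞) < t then 1 else 0) ?_ ?_ t
  · intro s t hst
    dsimp only
    gcongr with j k
    by_cases h : ((j + k : ℕ) : ℕ∞) < s
    · rw [if_pos h, if_pos (h.trans_le hst)]
    · rw [if_neg h]; exact zero_le
  · intro N
    rcases Nat.eq_zero_or_pos N with rfl | hN
    · rw [natCast_rpow_eq_ofReal (by linarith)]
      simp [Real.zero_rpow (show q ≠ 0 by linarith)]
    have hN' : (0 : ℝ) < N := by exact_mod_cast hN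
    have h1 : ∀ j : ℕ, ((N - j : ℕ) : ℝ≥0∞)
        ≤ ∑' k : ℕ, if ((j + k : ℕ) : ℕ∞) < (N : ℕ∞) then 1 else 0 := by
      intro j
      refine le_trans (le_of_eq ?_) (ENNReal.sum_le_tsum (Finset.range (N - j)))
      rw [Finset.sum_congr rfl (g := fun _ => (1 : ℝ≥0∞))]
      · simp
      · intro k hk
        have := Finset.mem_range.1 hk
        rw [if_pos (by exact_mod_cast (by omega : j + k < N))]
    have hsum : ((N : ℝ) ^ 2) ≤ 2 * ∑ j ∈ Finset.range N, ((N - j : ℕ) : ℝ) := by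
      have : N ^ 2 ≤ 2 * ∑ j ∈ Finset.range N, (N - j) := by
        rw [← Finset.sum_range_reflect, Finset.mul_sum]
        have h2 : ∀ j ∈ Finset.range N, 2 * (N - (N - 1 - j)) = 2 * (j + 1) := by
          intro j hj
          have := Finset.mem_range.1 hj
          omega
        rw [Finset.sum_congr rfl h2, ← Finset.mul_sum, Finset.sum_add_distrib, mul_add,
          mul_comm 2 (∑ i ∈ Finset.range N, i), Finset.sum_range_id_mul_two]
        simp
        rcases N with _ | N
        · simp
        · simp; nlinarith
      exact_mod_cast this
    calc (N : ℝ≥0∞) ^ q = ENNReal.ofReal ((N : ℝ) ^ (q - 2) * (N : ℝ) ^ 2) := by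
          rw [natCast_rpow_eq_ofReal (by linarith), ← Real.rpow_two, ← Real.rpow_add hN']
          ring_nf
      _ ≤ ENNReal.ofReal ((N : ℝ) ^ (q - 2) * (2 * ∑ j ∈ Finset.range N, ((N - j : ℕ) : ℝ))) := by
          gcongr
      _ = 2 * ∑ j ∈ Finset.range N, ENNReal.ofReal ((N : ℝ) ^ (q - 2)) * ((N - j : ℕ) : ℝ≥0∞) := by
          rw [← Finset.mul_sum, mul_left_comm, ENNReal.ofReal_mul (by norm_num),
            ENNReal.ofReal_mul (by positivity), ENNReal.ofReal_sum_of_nonneg (by simp)]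
          simp
      _ ≤ 2 * ∑ j ∈ Finset.range N, ENNReal.ofReal (((j : ℝ) + 1) ^ (q - 2))
            * ∑' k : ℕ, if ((j + k : ℕ) : ℕ∞) < (N : ℕ∞) then 1 else 0 := by
          refine mul_le_mul' le_rfl (Finset.sum_le_sum fun j hj => mul_le_mul' ?_ (h1 j))
          refine ENNReal.ofReal_le_ofReal
            (Real.rpow_le_rpow_of_nonpos (by positivity) ?_ (by linarith))
          exact_mod_cast Finset.mem_range.1 hj
      _ ≤ _ := by
          gcongr
          exact ENNReal.sum_le_tsum _

lemma indicator_avoids_eq (a : ℝ) (n : ℕ) (ξ : ℕ → X) :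
    (if (n : ℕ∞) < passageTime a ξ then (1 : ℝ≥0∞) else 0)
      = (avoids X a n).indicator (fun _ => 1) ξ := by
  classical
  rw [indicator_apply]
  exact if_congr (lt_passageTime_iff a n ξ) rfl rfl

lemma passageMoment_le_tsum (P : Kernel X X) [IsMarkovKernel P] {a : ℝ} {x : X}
    (hx : a < |(x : ℝ)|) {q : ℝ} (hq : 0 < q) (hq1 : q ≤ 1) :
    passageMoment P q a x ≤ ∑' k : ℕ, ENNReal.ofReal (((k : ℝ) + 1) ^ (q - 1))
      * (killed P a)^[k] (fun _ => 1) x := by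
  calc passageMoment P q a x
      ≤ ∫⁻ ξ, ∑' k : ℕ, ENNReal.ofReal (((k : ℝ) + 1) ^ (q - 1))
        * (avoids X a k).indicator (fun _ => 1) ξ ∂(pathLaw P x) := by
        refine lintegral_mono fun ξ => ?_
        simp_rw [← indicator_avoids_eq]
        exact enat_rpow_le_tsum hq hq1 _
    _ = _ := by
        have hm : ∀ k, Measurable ((avoids X a k).indicator (fun _ => (1 : ℝ≥0∞))) :=
          fun k => measurable_const.indicator (measurableSet_avoids a k)
        rw [lintegral_tsum fun k => ((hm k).const_mul _).aemeasurable]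
        congr 1 with k
        rw [lintegral_const_mul _ (hm k), ← pathLaw_avoids P hx,
          lintegral_indicator (measurableSet_avoids a k)]
        simp

lemma passageMoment_le_tsum_tsum (P : Kernel X X) [IsMarkovKernel P] {a : ℝ} {x : X}
    (hx : a < |(x : ℝ)|) {q : ℝ} (hq : 1 ≤ q) (hq2 : q ≤ 2) :
    passageMoment P q a x ≤ 2 * ∑' j : ℕ, ENNReal.ofReal (((j : ℝ) + 1) ^ (q - 2))
      * ∑' k : ℕ, (killed P a)^[j + k] (fun _ => 1) x := by
  have hm : ∀ k, Measurable ((avoids X a k).indicator (fun _ => (1 : ℝ≥0∞))) :=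
    fun k => measurable_const.indicator (measurableSet_avoids a k)
  have hm2 : ∀ j, Measurable fun ξ => ∑' k, (avoids X a (j + k)).indicator (fun _ => (1 : ℝ≥0∞)) ξ :=
    fun j => Measurable.tsum fun k => hm (j + k)
  calc passageMoment P q a x
      ≤ ∫⁻ ξ, 2 * ∑' j : ℕ, ENNReal.ofReal (((j : ℝ) + 1) ^ (q - 2))
        * ∑' k : ℕ, (avoids X a (j + k)).indicator (fun _ => 1) ξ ∂(pathLaw P x) := by
        refine lintegral_mono fun ξ => ?_
        simp_rw [← indicator_avoids_eq]
        exact enat_rpow_le_tsum_tsum hq hq2 _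
    _ = _ := by
        rw [lintegral_const_mul _ (Measurable.tsum fun j => (hm2 j).const_mul _),
          lintegral_tsum fun j => ((hm2 j).const_mul _).aemeasurable]
        congr 2 with j
        rw [lintegral_const_mul _ (hm2 j), lintegral_tsum fun k => (hm (j + k)).aemeasurable]
        congr 2 with k
        rw [← pathLaw_avoids P hx, lintegral_indicator (measurableSet_avoids a _)]
        simp

lemma rpow_mul_killed_le_setLIntegral (P : Kernel X X) [IsMarkovKernel P] {a : ℝ} {x : X}
    (hx : a < |(x : ℝ)|) {q : ℝ} (hq : 0 < q) (n : ℕ) :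
    (n : ℝ≥0∞) ^ q * (killed P a)^[n] (fun _ => 1) x
      ≤ ∫⁻ ξ in avoids X a n, ((passageTime a ξ : ℕ∞) : ℝ≥0∞) ^ q ∂(pathLaw P x) := by
  rw [← pathLaw_avoids P hx, ← setLIntegral_const]
  refine setLIntegral_mono' (measurableSet_avoids a n) fun ξ hξ => ?_
  refine ENNReal.rpow_le_rpow ?_ hq.le
  have := ((lt_passageTime_iff a n ξ).2 hξ).le
  exact_mod_cast ENat.toENNReal_le.2 this

lemma rpow_mul_killed_le_passageMoment (P : Kernel X X) [IsMarkovKernel P] {a : ℝ} {x : X}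
    (hx : a < |(x : ℝ)|) {q : ℝ} (hq : 0 < q) (n : ℕ) :
    (n : ℝ≥0∞) ^ q * (killed P a)^[n] (fun _ => 1) x ≤ passageMoment P q a x :=
  (rpow_mul_killed_le_setLIntegral P hx hq n).trans (setLIntegral_le_lintegral _ _)

/-- The plain Chebyshev bound gives boundedness only; convergence to zero is what reaches the
endpoint exponent when the drift dominates. It comes from integrating `τ ^ q` over the shrinking
events `τ > n`. -/
lemma tendsto_rpow_mul_killed (P : Kernel X X) [IsMarkovKernel P] {a : ℝ} {x : X}
    (hx : a < |(x : ℝ)|) {q : ℝ} (hq : 0 < q) (h : passageMoment P q a x < ⊤) :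
    Tendsto (fun n : ℕ => (n : ℝ≥0∞) ^ q * (killed P a)^[n] (fun _ => 1) x) atTop (𝓝 0) := by
  refine tendsto_of_tendsto_of_tendsto_of_le_of_le tendsto_const_nhds
    (tendsto_setLIntegral_zero h.ne (s := fun n => avoids X a n) ?_)
    (fun _ => zero_le) (rpow_mul_killed_le_setLIntegral P hx hq)
  have h1 : Tendsto (fun n : ℕ => (n : ℝ≥0∞) ^ q) atTop (𝓝 ⊤) := by
    have := (ENNReal.continuous_rpow_const (y := q)).tendsto ⊤
    rw [ENNReal.top_rpow_of_pos hq] at this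
    exact this.comp ENNReal.tendsto_nat_nhds_top
  -- Chebyshev makes these events' probabilities vanish, as absolute continuity of the integral
  -- requires.
  have h2 : Tendsto (fun n : ℕ => passageMoment P q a x / (n : ℝ≥0∞) ^ q) atTop (𝓝 0) := by
    simpa using ENNReal.Tendsto.const_div h1 (Or.inr h.ne)
  refine tendsto_of_tendsto_of_tendsto_of_le_of_le' tendsto_const_nhds h2
    (Eventually.of_forall fun _ => zero_le) ?_
  filter_upwards [eventually_gt_atTop 0] with n hn
  rw [ENNReal.le_div_iff_mul_le (Or.inl ?_) (Or.inl ?_), mul_comm, Function.comp_apply,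
    pathLaw_avoids P hx]
  · exact rpow_mul_killed_le_passageMoment P hx hq n
  · exact (ENNReal.rpow_pos (by exact_mod_cast hn) (by simp)).ne'
  · exact ENNReal.rpow_ne_top_of_nonneg hq.le (by simp)

/-- The sum is the mean of `min n τ`, and `min n τ ≤ n ^ (1 - q) * τ ^ q`. -/
lemma sum_killed_le_mul_passageMoment (P : Kernel X X) [IsMarkovKernel P] {a : ℝ} {x : X}
    (hx : a < |(x : ℝ)|) {q : ℝ} (hq : 0 < q) (hq1 : q ≤ 1) {n : ℕ} (hn : 0 < n) :
    ∑ k ∈ Finset.range n, (killed P a)^[k] (fun _ => 1) x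
      ≤ ENNReal.ofReal ((n : ℝ) ^ (1 - q)) * passageMoment P q a x := by
  have hm : ∀ k, Measurable ((avoids X a k).indicator (fun _ => (1 : ℝ≥0∞))) :=
    fun k => measurable_const.indicator (measurableSet_avoids a k)
  have hn' : (0 : ℝ) < n := by exact_mod_cast hn
  have hpt : ∀ t : ℕ∞, (∑ k ∈ Finset.range n, if (k : ℕ∞) < t then (1 : ℝ≥0∞) else 0)
      ≤ ENNReal.ofReal ((n : ℝ) ^ (1 - q)) * (t : ℝ≥0∞) ^ q := by
    intro t
    induction t using ENat.recTopCoe with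
    | top =>
      rw [ENat.toENNReal_top, ENNReal.top_rpow_of_pos hq, ENNReal.mul_top]
      · exact le_top
      · simpa using Real.rpow_pos_of_pos hn' _
    | coe N =>
      have h1 : (∑ k ∈ Finset.range n, if (k : ℕ∞) < (N : ℕ∞) then (1 : ℝ≥0∞) else 0)
          = ((min n N : ℕ) : ℝ≥0∞) := by
        rw [Finset.sum_ite]
        simp only [Finset.sum_const, nsmul_eq_mul, mul_one, mul_zero, add_zero]
        congr 1
        have : (Finset.range n).filter (fun k : ℕ => (k : ℕ∞) < (N : ℕ∞)) = Finset.range (min n N) := by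
          ext k; simp
        rw [this, Finset.card_range]
      rw [h1, ENat.toENNReal_coe, natCast_rpow_eq_ofReal hq.le, ← ENNReal.ofReal_mul (by positivity),
        ← ENNReal.ofReal_natCast]
      refine ENNReal.ofReal_le_ofReal ?_
      rcases Nat.eq_zero_or_pos (min n N) with h0 | h0
      · rw [h0]; simp only [Nat.cast_zero]; positivity
      · have h0' : (0 : ℝ) < ((min n N : ℕ) : ℝ) := by exact_mod_cast h0
        calc ((min n N : ℕ) : ℝ) = ((min n N : ℕ) : ℝ) ^ (1 - q) * ((min n N : ℕ) : ℝ) ^ q := by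
              rw [← Real.rpow_add h0']; simp
          _ ≤ _ := by
              have e1 : ((min n N : ℕ) : ℝ) ≤ n := by exact_mod_cast min_le_left n N
              have e2 : ((min n N : ℕ) : ℝ) ≤ N := by exact_mod_cast min_le_right n N
              exact mul_le_mul (Real.rpow_le_rpow h0'.le e1 (by linarith))
                (Real.rpow_le_rpow h0'.le e2 hq.le) (by positivity) (by positivity)
  calc ∑ k ∈ Finset.range n, (killed P a)^[k] (fun _ => 1) x
      = ∫⁻ ξ, ∑ k ∈ Finset.range n, (avoids X a k).indicator (fun _ => 1) ξ ∂(pathLaw P x) := by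
        rw [lintegral_finsetSum _ fun k _ => hm k]
        refine Finset.sum_congr rfl fun k _ => ?_
        rw [← pathLaw_avoids P hx, lintegral_indicator (measurableSet_avoids a _)]
        simp
    _ ≤ ∫⁻ ξ, ENNReal.ofReal ((n : ℝ) ^ (1 - q)) * ((passageTime a ξ : ℕ∞) : ℝ≥0∞) ^ q
          ∂(pathLaw P x) := by
        refine lintegral_mono fun ξ => ?_
        simp_rw [← indicator_avoids_eq]
        exact hpt _
    _ = _ := lintegral_const_mul' _ _ (by simp)

/-! ### Foster–Lyapunov criteria for finite moments -/

lemma rpow_neg_le_add {A w s : ℝ} (hA : 0 < A) (hw : 0 < w) (hs : 0 ≤ s) (hs1 : s ≤ 1) :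
    A ^ (-s) ≤ w ^ (-s) + A⁻¹ * w ^ (1 - s) := by
  rcases le_total w A with h | h
  · have h1 : A ^ (-s) ≤ w ^ (-s) := Real.rpow_le_rpow_of_nonpos hw h (by linarith)
    have h2 : 0 ≤ A⁻¹ * w ^ (1 - s) := by positivity
    linarith
  · have h1 : A ^ (1 - s) ≤ w ^ (1 - s) := Real.rpow_le_rpow hA.le h (by linarith)
    have h2 : A ^ (-s) = A⁻¹ * A ^ (1 - s) := by
      rw [← Real.rpow_neg_one, ← Real.rpow_add hA]; ring_nf
    have h3 : 0 ≤ w ^ (-s) := by positivity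
    rw [h2]
    have : A⁻¹ * A ^ (1 - s) ≤ A⁻¹ * w ^ (1 - s) := by gcongr
    linarith

lemma tsum_ofReal_succ_rpow_neg_lt_top {t : ℝ} (ht : 1 < t) :
    ∑' k : ℕ, ENNReal.ofReal (((k : ℝ) + 1) ^ (-t)) < ⊤ := by
  have h := (summable_nat_add_iff 1).2 (Real.summable_nat_rpow.2 (show -t < -1 by linarith))
  have := h.tsum_ofReal_ne_top
  simpa [lt_top_iff_ne_top] using this

lemma tsum_killed_iterate_lt_top (P : Kernel X X) {a ε p p' : ℝ} (hε : 0 < ε) {w : X → ℝ}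
    (hw : Measurable w)
    (h : ∀ x : X, a < |(x : ℝ)| → killed P a (fun z => ENNReal.ofReal (w z ^ p)) x
      + ENNReal.ofReal ε * ENNReal.ofReal (w x ^ p') ≤ ENNReal.ofReal (w x ^ p))
    {x : X} (hx : a < |(x : ℝ)|) :
    ∑' k, (killed P a)^[k] (fun z => ENNReal.ofReal (w z ^ p')) x < ⊤ := by
  have h1 := tsum_killed_iterate_le P (by fun_prop) h hx
  simp_rw [killed_iterate_const_mul P a _ (ENNReal.ofReal ε)
    (f := fun z => ENNReal.ofReal (w z ^ p')) (by fun_prop)] at h1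
  rw [ENNReal.tsum_mul_left] at h1
  by_contra hne
  rw [not_lt, top_le_iff] at hne
  rw [hne, ENNReal.mul_top (by simpa using hε)] at h1
  exact absurd h1 (by simp)

lemma killed_iterate_rpow_le (P : Kernel X X) {a ε p p' : ℝ} {w : X → ℝ}
    (hw : Measurable w)
    (h : ∀ x : X, a < |(x : ℝ)| → killed P a (fun z => ENNReal.ofReal (w z ^ p)) x
      + ENNReal.ofReal ε * ENNReal.ofReal (w x ^ p') ≤ ENNReal.ofReal (w x ^ p))
    {x : X} (hx : a < |(x : ℝ)|) (n : ℕ) :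
    (killed P a)^[n] (fun z => ENNReal.ofReal (w z ^ p)) x ≤ ENNReal.ofReal (w x ^ p) :=
  killed_iterate_le P (by fun_prop) (fun x hx => le_self_add.trans (h x hx)) hx n

/-- With `A = (k+1) ^ t`, the weighted power is at most `w ^ (p-1) + A⁻¹ w ^ p`, according to
whether `w ≤ A` or not. The first part is summed by the telescoped loss; for the second, `w ^ p`
stays bounded in mean and `∑ (k+1) ^ (-t)` converges. -/
lemma sum_weighted_killed_lt_top (P : Kernel X X) {a ε p s t : ℝ} (hε : 0 < ε)
    (hs : 0 ≤ s) (hs1 : s ≤ 1) (ht : 1 < t) {w : X → ℝ} (hw : Measurable w)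
    (hw0 : ∀ x : X, a < |(x : ℝ)| → 0 < w x)
    (h : ∀ x : X, a < |(x : ℝ)| → killed P a (fun z => ENNReal.ofReal (w z ^ p)) x
      + ENNReal.ofReal ε * ENNReal.ofReal (w x ^ (p - 1)) ≤ ENNReal.ofReal (w x ^ p))
    {x : X} (hx : a < |(x : ℝ)|) :
    ∑' k : ℕ, ENNReal.ofReal (((k : ℝ) + 1) ^ (-(t * s)))
      * (killed P a)^[k] (fun z => ENNReal.ofReal (w z ^ (p - 1 + s))) x < ⊤ := by
  have hterm : ∀ k : ℕ, ENNReal.ofReal (((k : ℝ) + 1) ^ (-(t * s)))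
      * (killed P a)^[k] (fun z => ENNReal.ofReal (w z ^ (p - 1 + s))) x
      ≤ (killed P a)^[k] (fun z => ENNReal.ofReal (w z ^ (p - 1))) x
        + ENNReal.ofReal (((k : ℝ) + 1) ^ (-t)) * ENNReal.ofReal (w x ^ p) := by
    intro k
    have hk : (0 : ℝ) < (k : ℝ) + 1 := by positivity
    rw [← killed_iterate_const_mul P a k _ (by fun_prop)]
    refine le_trans ?_ (add_le_add_right (mul_le_mul_right
      (killed_iterate_rpow_le P hw h hx k) _) _)
    rw [← killed_iterate_const_mul P a k _ (by fun_prop),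
      ← killed_iterate_add P a k (by fun_prop)]
    refine killed_iterate_mono P a k (fun z hz => ?_) hx
    have hz0 := hw0 z hz
    rw [← ENNReal.ofReal_mul (by positivity), ← ENNReal.ofReal_mul (by positivity),
      ← ENNReal.ofReal_add (by positivity) (by positivity)]
    refine ENNReal.ofReal_le_ofReal ?_
    have h1 := rpow_neg_le_add (Real.rpow_pos_of_pos hk t) hz0 hs hs1
    rw [← Real.rpow_mul hk.le, ← Real.rpow_neg hk.le] at h1
    have h2 := mul_le_mul_of_nonneg_right h1 (Real.rpow_nonneg hz0.le (p - 1 + s))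
    rw [add_mul, mul_assoc, ← Real.rpow_add hz0, ← Real.rpow_add hz0] at h2
    rw [show -s + (p - 1 + s) = p - 1 by ring, show 1 - s + (p - 1 + s) = p by ring] at h2
    rwa [← mul_neg]
  refine (ENNReal.tsum_le_tsum hterm).trans_lt ?_
  rw [ENNReal.tsum_add, ENNReal.tsum_mul_right]
  exact ENNReal.add_lt_top.2 ⟨tsum_killed_iterate_lt_top P hε hw h hx,
    ENNReal.mul_lt_top (tsum_ofReal_succ_rpow_neg_lt_top ht) (by simp)⟩

/-- Finite passage-time moments of order `q < p < 1` from a Foster–Lyapunov function. -/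
lemma passageMoment_lt_top_of_lt_one (P : Kernel X X) [IsMarkovKernel P] {a ε p q : ℝ}
    (hε : 0 < ε) (hq : 0 < q) (hqp : q < p) (hp : p < 1) {w : X → ℝ} (hw : Measurable w)
    (hw0 : ∀ x : X, a < |(x : ℝ)| → 0 < w x)
    (h : ∀ x : X, a < |(x : ℝ)| → killed P a (fun z => ENNReal.ofReal (w z ^ p)) x
      + ENNReal.ofReal ε * ENNReal.ofReal (w x ^ (p - 1)) ≤ ENNReal.ofReal (w x ^ p))
    {x : X} (hx : a < |(x : ℝ)|) : passageMoment P q a x < ⊤ := by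
  refine (passageMoment_le_tsum P hx hq (by linarith)).trans_lt ?_
  have h1p : 0 < 1 - p := by linarith
  -- `s = 1 - p` turns the power of `w` into the constant `1`. The choice of `t` makes the weight
  -- `(k+1) ^ (q-1)`, and `t > 1` is exactly `q < p`.
  have := sum_weighted_killed_lt_top P (s := 1 - p) (t := (1 - q) / (1 - p)) hε h1p.le
    (by linarith) (by rw [one_lt_div h1p]; linarith) hw hw0 h hx
  have e : -((1 - q) / (1 - p) * (1 - p)) = q - 1 := by field_simp; ring
  rw [e] at this
  simpa using this

/-- Finite passage-time moments of order `1 ≤ q < p < 2` from a pair of Foster–Lyapunov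
functions. -/
lemma passageMoment_lt_top_of_one_le (P : Kernel X X) [IsMarkovKernel P] {a ε p q : ℝ}
    (hε : 0 < ε) (hq : 1 ≤ q) (hqp : q < p) (hp : p < 2) {w : X → ℝ} (hw : Measurable w)
    (hw0 : ∀ x : X, a < |(x : ℝ)| → 0 < w x)
    (h1 : ∀ x : X, a < |(x : ℝ)| → killed P a (fun z => ENNReal.ofReal (w z)) x
      + ENNReal.ofReal ε ≤ ENNReal.ofReal (w x))
    (h : ∀ x : X, a < |(x : ℝ)| → killed P a (fun z => ENNReal.ofReal (w z ^ p)) x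
      + ENNReal.ofReal ε * ENNReal.ofReal (w x ^ (p - 1)) ≤ ENNReal.ofReal (w x ^ p))
    {x : X} (hx : a < |(x : ℝ)|) : passageMoment P q a x < ⊤ := by
  refine (passageMoment_le_tsum_tsum P hx hq (by linarith)).trans_lt ?_
  have hε' : ENNReal.ofReal ε ≠ 0 := by simpa using hε
  have h2p : 0 < 2 - p := by linarith
  -- Given survival to time `j`, the expected remaining time is at most `w / ε` at the current
  -- state.
  have hinner : ∀ j : ℕ, ∑' k : ℕ, (killed P a)^[j + k] (fun _ => 1) x
      ≤ (ENNReal.ofReal ε)⁻¹ * (killed P a)^[j] (fun z => ENNReal.ofReal (w z)) x := by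
    intro j
    have hm : ∀ k, Measurable ((killed P a)^[k] (fun _ => 1)) :=
      fun k => measurable_killed_iterate P a k measurable_const
    have hs : ∀ n : ℕ, ∑ k ∈ Finset.range n, (killed P a)^[j + k] (fun _ => 1) x
        = (killed P a)^[j] (fun z => ∑ k ∈ Finset.range n, (killed P a)^[k] (fun _ => 1) z) x := by
      intro n
      induction n with
      | zero =>
        have := killed_iterate_const_mul P a j 0 (f := fun _ => 1) measurable_const x
        simpa using this.symm
      | succ n ih =>
        simp only [Finset.sum_range_succ]
        rw [killed_iterate_add P a j (Finset.measurable_fun_sum _ fun k _ => hm k), ih,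
          Function.iterate_add_apply]
    rw [ENNReal.tsum_eq_iSup_nat]
    refine iSup_le fun n => ?_
    rw [hs, ← killed_iterate_const_mul P a j _ (by fun_prop)]
    refine killed_iterate_mono P a j (fun z hz => ?_) hx
    have h3 := le_add_self.trans (killed_iterate_add_sum_le P (a := a)
      (f := fun z => ENNReal.ofReal (w z)) (g := fun _ => ENNReal.ofReal ε * 1)
      (by fun_prop) (by simpa using h1) hz n)
    simp_rw [killed_iterate_const_mul P a _ (ENNReal.ofReal ε) (f := fun _ => 1)
      measurable_const] at h3
    rw [← Finset.mul_sum] at h3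
    rwa [mul_comm, ← div_eq_mul_inv, ENNReal.le_div_iff_mul_le (Or.inl hε')
      (Or.inl ENNReal.ofReal_ne_top), mul_comm]
  -- `s = 2 - p` leaves `w` to the first power, as in `hinner`; `t > 1` is again `q < p`.
  have h4 := sum_weighted_killed_lt_top P (s := 2 - p) (t := (2 - q) / (2 - p)) hε h2p.le
    (by linarith) (by rw [one_lt_div h2p]; linarith) hw hw0 h hx
  have e : -((2 - q) / (2 - p) * (2 - p)) = q - 2 := by field_simp; ring
  have e2 : p - 1 + (2 - p) = 1 := by ring
  simp only [e, e2, Real.rpow_one] at h4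
  refine ENNReal.mul_lt_top (by simp) ?_
  calc _ ≤ ∑' j : ℕ, (ENNReal.ofReal ε)⁻¹ * (ENNReal.ofReal (((j : ℝ) + 1) ^ (q - 2))
        * (killed P a)^[j] (fun z => ENNReal.ofReal (w z)) x) := by
        refine ENNReal.tsum_le_tsum fun j => ?_
        rw [mul_left_comm]
        gcongr
        exact hinner j
    _ < ⊤ := by
        rw [ENNReal.tsum_mul_left]
        exact ENNReal.mul_lt_top (by simpa using hε) h4

/-! ### Criteria for infinite moments -/

lemma rpow_le_add_rpow {T z ν r : ℝ} (hT : 0 < T) (hz : 0 ≤ z) (hν : 0 < ν) (hνr : ν < r) :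
    z ^ ν ≤ T ^ ν + T ^ (ν - r) * z ^ r := by
  rcases le_total z T with h | h
  · have : z ^ ν ≤ T ^ ν := Real.rpow_le_rpow hz h hν.le
    have : 0 ≤ T ^ (ν - r) * z ^ r := by positivity
    linarith
  · have hz' : 0 < z := hT.trans_le h
    have h1 : z ^ (ν - r) ≤ T ^ (ν - r) := Real.rpow_le_rpow_of_nonpos hT h (by linarith)
    have h2 : z ^ ν = z ^ (ν - r) * z ^ r := by rw [← Real.rpow_add hz']; ring_nf
    have h3 : z ^ (ν - r) * z ^ r ≤ T ^ (ν - r) * z ^ r := by gcongr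
    have : 0 ≤ T ^ ν := by positivity
    linarith

/-- Truncation at level `T`: below it only the survival probability matters, above it the higher
power `r` pays. -/
lemma killed_iterate_rpow_sub_le (P : Kernel X X) {a T ν r : ℝ} (ha : 0 ≤ a) (hT : 0 < T)
    (hν : 0 < ν) (hνr : ν < r) (n : ℕ) {x : X} (hx : a < |(x : ℝ)|) :
    (killed P a)^[n] (fun z => ENNReal.ofReal (|(z : ℝ)| ^ ν - a ^ ν)) x
      ≤ ENNReal.ofReal (T ^ ν) * (killed P a)^[n] (fun _ => 1) x
        + ENNReal.ofReal (T ^ (ν - r))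
          * (killed P a)^[n] (fun z => ENNReal.ofReal (|(z : ℝ)| ^ r)) x := by
  rw [← killed_iterate_const_mul P a n _ measurable_const,
    ← killed_iterate_const_mul P a n _ (by fun_prop), ← killed_iterate_add P a n (by fun_prop)]
  refine killed_iterate_mono P a n (fun z hz => ?_) hx
  rw [← ENNReal.ofReal_mul (by positivity), mul_one, ← ENNReal.ofReal_add (by positivity)
    (by positivity)]
  refine ENNReal.ofReal_le_ofReal ?_
  have := rpow_le_add_rpow hT (abs_nonneg (z : ℝ)) hν hνr
  have : 0 ≤ a ^ ν := by positivity
  linarith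

/-- Infinite passage-time moments from a submartingale `|ξ|^ν` and a bound on the growth of a
higher power. -/
lemma passageMoment_eq_top_of_submartingale (P : Kernel X X) [IsMarkovKernel P] {a ν r q : ℝ}
    {C : ℝ≥0∞} (hC : C ≠ ⊤) (ha : 0 ≤ a) (hν : 0 < ν) (hνr : ν < r) (hq : 0 < q) (hq1 : q < 1)
    (hνrq : ν / r < q)
    (h1 : ∀ x : X, a < |(x : ℝ)| → ENNReal.ofReal (|(x : ℝ)| ^ ν - a ^ ν)
      ≤ killed P a (fun z => ENNReal.ofReal (|(z : ℝ)| ^ ν - a ^ ν)) x)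
    (h2 : ∀ x : X, a < |(x : ℝ)| → killed P a (fun z => ENNReal.ofReal (|(z : ℝ)| ^ r)) x
      ≤ ENNReal.ofReal (|(x : ℝ)| ^ r) + C)
    {x : X} (hx : a < |(x : ℝ)|) : passageMoment P q a x = ⊤ := by
  by_contra hne
  set M := passageMoment P q a x with hM
  have hr : 0 < r := hν.trans hνr
  have hδ : 0 < |(x : ℝ)| ^ ν - a ^ ν := by
    have := Real.rpow_lt_rpow ha hx hν
    linarith
  set R := ENNReal.ofReal (|(x : ℝ)| ^ r) with hR
  have key : ∀ n : ℕ, 0 < n → ENNReal.ofReal (|(x : ℝ)| ^ ν - a ^ ν)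
      ≤ ENNReal.ofReal ((n : ℝ) ^ (ν / r - q)) * (M + R + C * M) := by
    intro n hn
    have hn' : (1 : ℝ) ≤ n := by exact_mod_cast hn
    have hn0 : (0 : ℝ) < n := by linarith
    -- If the moment `M` is finite, survival is at most `n ^ (-q) M` and the mean of `|ξ| ^ r` is at
    -- most `R + C n ^ (1-q) M`. This level balances the two truncation terms at order `n ^ (ν/r -
    -- q)`, which tends to zero, whereas the submartingale keeps a positive lower bound.
    set T := (n : ℝ) ^ (1 / r) with hT
    have hT0 : 0 < T := by positivity
    have s1 := le_killed_iterate_add_sum P (g := fun _ => 0)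
      (f := fun z : X => ENNReal.ofReal (|(z : ℝ)| ^ ν - a ^ ν)) (by fun_prop)
      (fun x hx => by simpa using h1 x hx) hx n
    have s0 : ∀ k, (killed P a)^[k] (fun _ => 0) x = 0 := by
      intro k
      simpa using killed_iterate_const_mul P a k 0 (f := fun _ => 1) measurable_const x
    simp only [s0, Finset.sum_const_zero, add_zero] at s1
    have s2 := s1.trans (killed_iterate_rpow_sub_le P ha hT0 hν hνr n hx)
    have s3 := killed_iterate_le_add_sum P (g := fun _ => C * 1)
      (f := fun z : X => ENNReal.ofReal (|(z : ℝ)| ^ r)) (by fun_prop)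
      (fun x hx => by simpa using h2 x hx) hx n
    simp_rw [killed_iterate_const_mul P a _ C (f := fun _ => 1) measurable_const] at s3
    rw [← Finset.mul_sum] at s3
    have s4 := sum_killed_le_mul_passageMoment P hx hq hq1.le hn
    have s5 : (killed P a)^[n] (fun _ => 1) x ≤ ENNReal.ofReal ((n : ℝ) ^ (-q)) * M := by
      have s6 := rpow_mul_killed_le_passageMoment P hx hq n
      rw [natCast_rpow_eq_ofReal hq.le] at s6
      have s7 := mul_le_mul_right s6 (ENNReal.ofReal ((n : ℝ) ^ (-q)))
      rwa [← mul_assoc, ← ENNReal.ofReal_mul (by positivity), ← Real.rpow_add hn0,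
        neg_add_cancel, Real.rpow_zero, ENNReal.ofReal_one, one_mul] at s7
    have e1 : T ^ ν * (n : ℝ) ^ (-q) = (n : ℝ) ^ (ν / r - q) := by
      rw [hT, ← Real.rpow_mul hn0.le, ← Real.rpow_add hn0]; ring_nf
    have e2 : T ^ (ν - r) * (n : ℝ) ^ (1 - q) = (n : ℝ) ^ (ν / r - q) := by
      rw [hT, ← Real.rpow_mul hn0.le, ← Real.rpow_add hn0]
      congr 1; field_simp; ring
    have e3 : T ^ (ν - r) ≤ (n : ℝ) ^ (ν / r - q) := by
      rw [← e2]
      exact le_mul_of_one_le_right (by positivity) (Real.one_le_rpow hn' (by linarith))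
    calc ENNReal.ofReal (|(x : ℝ)| ^ ν - a ^ ν)
        ≤ ENNReal.ofReal (T ^ ν) * (ENNReal.ofReal ((n : ℝ) ^ (-q)) * M)
          + ENNReal.ofReal (T ^ (ν - r))
            * (R + C * (ENNReal.ofReal ((n : ℝ) ^ (1 - q)) * M)) := by
          refine s2.trans ?_
          gcongr
          exact s3.trans (by gcongr)
      _ = ENNReal.ofReal (T ^ ν * (n : ℝ) ^ (-q)) * M + ENNReal.ofReal (T ^ (ν - r)) * R
          + ENNReal.ofReal (T ^ (ν - r) * (n : ℝ) ^ (1 - q)) * (C * M) := by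
          rw [ENNReal.ofReal_mul (by positivity), ENNReal.ofReal_mul (by positivity)]
          ring
      _ ≤ ENNReal.ofReal ((n : ℝ) ^ (ν / r - q)) * M + ENNReal.ofReal ((n : ℝ) ^ (ν / r - q)) * R
          + ENNReal.ofReal ((n : ℝ) ^ (ν / r - q)) * (C * M) := by
          rw [e1, e2]
          gcongr
      _ = _ := by ring
  have hlim : Tendsto (fun n : ℕ => ENNReal.ofReal ((n : ℝ) ^ (ν / r - q)) * (M + R + C * M))
      atTop (𝓝 0) := by
    have t1 : Tendsto (fun n : ℕ => (n : ℝ) ^ (ν / r - q)) atTop (𝓝 0) := by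
      have := (tendsto_rpow_neg_atTop (y := q - ν / r) (by linarith)).comp
        tendsto_natCast_atTop_atTop
      simpa [Function.comp_def] using this
    have t2 := ENNReal.Tendsto.mul_const (b := M + R + C * M) (ENNReal.tendsto_ofReal t1)
      (Or.inr (ENNReal.add_ne_top.2 ⟨ENNReal.add_ne_top.2 ⟨hne, ENNReal.ofReal_ne_top⟩,
        ENNReal.mul_ne_top hC hne⟩))
    simpa using t2
  have := ge_of_tendsto hlim (by filter_upwards [eventually_gt_atTop 0] with n hn using key n hn)
  rw [nonpos_iff_eq_zero, ENNReal.ofReal_eq_zero] at this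
  linarith

/-- A chain started far away stays away from `[-a, a]` for a time of the order of the Lyapunov
function `|x|^κ`, with probability bounded below. -/
lemma exists_le_killed_iterate_one (P : Kernel X X) [IsMarkovKernel P] {a κ r C : ℝ}
    (ha : 0 < a) (hC : 0 < C) (hκ : 1 ≤ κ) (hκr : κ < r)
    (h1 : ∀ x : X, a < |(x : ℝ)| → ENNReal.ofReal (|(x : ℝ)| ^ κ - a ^ κ)
      ≤ killed P a (fun z => ENNReal.ofReal (|(z : ℝ)| ^ κ - a ^ κ)) x + ENNReal.ofReal C)
    (h2 : ∀ x : X, a < |(x : ℝ)| → killed P a (fun z => ENNReal.ofReal (|(z : ℝ)| ^ r)) x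
      ≤ ENNReal.ofReal (|(x : ℝ)| ^ r)) :
    ∃ δ > 0, ∃ δ' > 0, ∀ y : X, 4 * a ≤ |(y : ℝ)| → ∀ n : ℕ, (n : ℝ) ≤ δ * |(y : ℝ)| ^ κ →
      ENNReal.ofReal δ' ≤ (killed P a)^[n] (fun _ => 1) y := by
  have hκ0 : 0 < κ := by linarith
  -- With truncation at `K Y`, the part above the level contributes at most `Y ^ κ / 8`.
  obtain ⟨K, hK, hK8⟩ : ∃ K : ℝ, 0 < K ∧ K ^ (κ - r) = 1 / 8 := by
    refine ⟨(1 / 8) ^ (1 / (κ - r)), by positivity, ?_⟩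
    rw [← Real.rpow_mul (by norm_num), one_div_mul_cancel (by linarith), Real.rpow_one]
  refine ⟨1 / (8 * C), by positivity, 1 / (2 * K ^ κ), by positivity, fun y hy n hn => ?_⟩
  have hya : a < |(y : ℝ)| := by linarith
  have hy0 : 0 < |(y : ℝ)| := by linarith
  set Y := |(y : ℝ)| with hY
  have s1 := le_killed_iterate_add_sum P (g := fun _ => ENNReal.ofReal C * 1)
    (f := fun z : X => ENNReal.ofReal (|(z : ℝ)| ^ κ - a ^ κ)) (by fun_prop)
    (fun x hx => by simpa using h1 x hx) hya n
  simp_rw [killed_iterate_const_mul P a _ (ENNReal.ofReal C) (f := fun _ => 1)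
    measurable_const] at s1
  have s2 : ∑ k ∈ Finset.range n, ENNReal.ofReal C * (killed P a)^[k] (fun _ => 1) y
      ≤ ENNReal.ofReal (n * C) := by
    calc _ ≤ ∑ k ∈ Finset.range n, ENNReal.ofReal C * 1 := by
          gcongr
          exact killed_iterate_one_le P a _ hya
      _ = _ := by
          rw [ENNReal.ofReal_mul (by positivity)]; simp
  have s3 := killed_iterate_rpow_sub_le P (T := K * Y) ha.le (by positivity) hκ0 hκr n hya
  have s4 := killed_iterate_le P (by fun_prop) h2 hya n
  have hS1 := killed_iterate_one_le P a n hya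
  obtain ⟨s, hs0, hs⟩ : ∃ s : ℝ, 0 ≤ s ∧ (killed P a)^[n] (fun _ => 1) y = ENNReal.ofReal s :=
    ⟨_, ENNReal.toReal_nonneg, (ENNReal.ofReal_toReal (ne_top_of_le_ne_top (by simp) hS1)).symm⟩
  have s5 : ENNReal.ofReal (Y ^ κ - a ^ κ) ≤ ENNReal.ofReal ((K * Y) ^ κ) * ENNReal.ofReal s
      + ENNReal.ofReal ((K * Y) ^ (κ - r)) * ENNReal.ofReal (Y ^ r) + ENNReal.ofReal (n * C) := by
    refine s1.trans (add_le_add (s3.trans ?_) s2)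
    rw [hs]
    gcongr
  rw [← ENNReal.ofReal_mul (by positivity), ← ENNReal.ofReal_mul (by positivity),
    ← ENNReal.ofReal_add (by positivity) (by positivity),
    ← ENNReal.ofReal_add (by positivity) (by positivity),
    ENNReal.ofReal_le_ofReal_iff (by positivity), Real.mul_rpow hK.le hy0.le,
    Real.mul_rpow hK.le hy0.le, hK8, mul_assoc (1 / 8), ← Real.rpow_add hy0,
    sub_add_cancel] at s5
  have hYκ : 0 < Y ^ κ := by positivity
  have s6 : 4 * a ^ κ ≤ Y ^ κ := by
    calc 4 * a ^ κ ≤ 4 ^ κ * a ^ κ := by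
          gcongr
          calc (4 : ℝ) = 4 ^ (1 : ℝ) := (Real.rpow_one 4).symm
            _ ≤ 4 ^ κ := Real.rpow_le_rpow_of_exponent_le (by norm_num) hκ
      _ = (4 * a) ^ κ := (Real.mul_rpow (by norm_num) ha.le).symm
      _ ≤ Y ^ κ := Real.rpow_le_rpow (by positivity) hy hκ0.le
  have s7 : n * C ≤ Y ^ κ / 8 := by
    calc n * C ≤ 1 / (8 * C) * Y ^ κ * C := by gcongr
      _ = Y ^ κ / 8 := by field_simp
  rw [hs]
  refine ENNReal.ofReal_le_ofReal ?_
  have hKκ : 0 < K ^ κ := by positivity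
  rw [div_le_iff₀ (by positivity)]
  -- Out of `Y ^ κ`, at most `1/4` is lost to `a ^ κ`, `1/8` to the accumulated decrease and `1/8`
  -- to the part above `K Y`. The remaining half must be carried by survival below `K Y`.
  have s8 : Y ^ κ * (1 / 2) ≤ Y ^ κ * (K ^ κ * s) := by nlinarith
  have := le_of_mul_le_mul_left s8 hYκ
  nlinarith

/-- Infinite critical passage-time moments caused by a single jump across the origin. -/
lemma passageMoment_eq_top_of_jump (P : Kernel X X) [IsMarkovKernel P] {a κ δ δ' β c' L₀ q : ℝ}
    (ha : 0 < a) (hδ : 0 < δ) (hδ' : 0 < δ') (hκ : 0 < κ) (hβ : 0 < β) (hc' : 0 < c')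
    (hq : β / κ ≤ q)
    (h1 : ∀ y : X, 4 * a ≤ |(y : ℝ)| → ∀ n : ℕ, (n : ℝ) ≤ δ * |(y : ℝ)| ^ κ →
      ENNReal.ofReal δ' ≤ (killed P a)^[n] (fun _ => 1) y)
    {x : X} (hx : a < |(x : ℝ)|)
    (h2 : ∀ L, L₀ ≤ L → ENNReal.ofReal (c' * L ^ (-β)) ≤ P x {z : X | L ≤ |(z : ℝ)|}) :
    passageMoment P q a x = ⊤ := by
  by_contra hne
  have hβκ : 0 < β / κ := by positivity
  have hq0 : 0 < q := hβκ.trans_le hq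
  -- The shift by one accounts for the initial jump, after which `n` steps of survival are required.
  have hlim := (tendsto_add_atTop_iff_nat 1).2
    (tendsto_rpow_mul_killed P hx hq0 (lt_top_iff_ne_top.2 hne))
  have key : ∀ᶠ n : ℕ in atTop, ENNReal.ofReal (δ' * (c' * δ ^ (β / κ)))
      ≤ ((n + 1 : ℕ) : ℝ≥0∞) ^ q * (killed P a)^[n + 1] (fun _ => 1) x := by
    have hL : Tendsto (fun n : ℕ => ((n : ℝ) / δ) ^ (1 / κ)) atTop atTop :=
      (tendsto_rpow_atTop (by positivity)).comp
        (tendsto_natCast_atTop_atTop.atTop_div_const hδ)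
    filter_upwards [hL.eventually_ge_atTop (max L₀ (4 * a)), eventually_gt_atTop 0] with n hn hn0
    have hn0' : (0 : ℝ) < n := by exact_mod_cast hn0
    -- Chosen with `δ * L ^ κ = n`: a landing point beyond `L` survives `n` further steps with
    -- probability at least `δ'`.
    set L := ((n : ℝ) / δ) ^ (1 / κ) with hLdef
    have hL0 : 0 < L := by positivity
    have hLκ : δ * L ^ κ = n := by
      rw [hLdef, ← Real.rpow_mul (by positivity), one_div_mul_cancel hκ.ne', Real.rpow_one]
      field_simp
    have hLβ : L ^ (-β) = δ ^ (β / κ) * (n : ℝ) ^ (-(β / κ)) := by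
      rw [hLdef, ← Real.rpow_mul (by positivity), Real.div_rpow hn0'.le hδ.le,
        show 1 / κ * -β = -(β / κ) by ring, Real.rpow_neg hδ.le]
      field_simp
    have s1 : ENNReal.ofReal δ' * ENNReal.ofReal (c' * L ^ (-β))
        ≤ (killed P a)^[n + 1] (fun _ => 1) x := by
      rw [Function.iterate_succ_apply']
      have hms : MeasurableSet {z : X | L ≤ |(z : ℝ)|} :=
        measurableSet_le measurable_const (by fun_prop)
      calc ENNReal.ofReal δ' * ENNReal.ofReal (c' * L ^ (-β))
          ≤ ENNReal.ofReal δ' * P x {z : X | L ≤ |(z : ℝ)|} := by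
            gcongr
            exact h2 L ((le_max_left _ _).trans hn)
        _ = ∫⁻ z, {z : X | L ≤ |(z : ℝ)|}.indicator (fun _ => ENNReal.ofReal δ') z ∂(P x) := by
            rw [lintegral_indicator hms, setLIntegral_const]
        _ ≤ _ := by
            refine lintegral_mono fun z => ?_
            by_cases hz : L ≤ |(z : ℝ)|
            · have h4 : 4 * a ≤ |(z : ℝ)| := ((le_max_right _ _).trans hn).trans hz
              have h5 : z ∈ {z : X | a < |(z : ℝ)|} := show a < |(z : ℝ)| by linarith
              rw [indicator_of_mem (show z ∈ {z : X | L ≤ |(z : ℝ)|} from hz),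
                indicator_of_mem h5]
              refine h1 z h4 n ?_
              rw [← hLκ]
              gcongr
            · rw [indicator_of_notMem (show z ∉ {z : X | L ≤ |(z : ℝ)|} from hz)]
              exact zero_le
    have s2 : ENNReal.ofReal ((n : ℝ) ^ (β / κ)) ≤ ((n + 1 : ℕ) : ℝ≥0∞) ^ q := by
      rw [natCast_rpow_eq_ofReal hq0.le]
      refine ENNReal.ofReal_le_ofReal ?_
      calc (n : ℝ) ^ (β / κ) ≤ ((n + 1 : ℕ) : ℝ) ^ (β / κ) := by
            gcongr; simp
        _ ≤ _ := Real.rpow_le_rpow_of_exponent_le (by simp) hq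
    refine le_trans (le_of_eq ?_) (mul_le_mul' s2 s1)
    rw [← ENNReal.ofReal_mul hδ'.le, ← ENNReal.ofReal_mul (by positivity), hLβ]
    congr 1
    have : (n : ℝ) ^ (β / κ) * (n : ℝ) ^ (-(β / κ)) = 1 := by
      rw [← Real.rpow_add hn0']; simp
    calc _ = δ' * (c' * δ ^ (β / κ)) * 1 := by ring
      _ = _ := by rw [← this]; ring
  have := ge_of_tendsto hlim key
  rw [nonpos_iff_eq_zero, ENNReal.ofReal_eq_zero] at this
  have : 0 < δ' * (c' * δ ^ (β / κ)) := by positivity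
  linarith

/-! ### Beta integrals -/

lemma integrableOn_beta {p q : ℝ} (hp : 0 < p) (hq : 0 < q) :
    IntegrableOn (fun u : ℝ => u ^ (p - 1) * (1 - u) ^ (q - 1)) (Ioo 0 1) := by
  have h := Complex.betaIntegral_convergent (u := p) (v := q) (by simpa) (by simpa)
  rw [intervalIntegrable_iff_integrableOn_Ioo_of_le zero_le_one] at h
  refine (Integrable.re h).congr ?_
  filter_upwards [ae_restrict_mem measurableSet_Ioo] with u hu
  have h1 : (0 : ℝ) ≤ 1 - u := by linarith [hu.2]
  have e : (u : ℂ) ^ ((p : ℂ) - 1) * (1 - (u : ℂ)) ^ ((q : ℂ) - 1)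
      = ((u ^ (p - 1) * (1 - u) ^ (q - 1) : ℝ) : ℂ) := by
    push_cast [Complex.ofReal_cpow hu.1.le, Complex.ofReal_cpow h1]
    rfl
  rw [e]
  simp

lemma integral_beta {p q : ℝ} (hp : 0 < p) (hq : 0 < q) :
    ∫ u in Ioo (0 : ℝ) 1, u ^ (p - 1) * (1 - u) ^ (q - 1) = beta p q := by
  rw [beta_eq_betaIntegralReal p q hp hq, Complex.betaIntegral,
    intervalIntegral.integral_of_le zero_le_one, integral_Ioc_eq_integral_Ioo,
    ← RCLike.re_to_complex, ← integral_re]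
  · refine setIntegral_congr_fun measurableSet_Ioo fun u hu => ?_
    have h1 : (0 : ℝ) ≤ 1 - u := by linarith [hu.2]
    have e : (u : ℂ) ^ ((p : ℂ) - 1) * (1 - (u : ℂ)) ^ ((q : ℂ) - 1)
        = ((u ^ (p - 1) * (1 - u) ^ (q - 1) : ℝ) : ℂ) := by
      push_cast [Complex.ofReal_cpow hu.1.le, Complex.ofReal_cpow h1]
      rfl
    simp only [e]
    simp
  · have h := Complex.betaIntegral_convergent (u := p) (v := q) (by simpa) (by simpa)
    rwa [intervalIntegrable_iff_integrableOn_Ioo_of_le zero_le_one] at h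

lemma image_inv_Ioo_zero_one : (fun v : ℝ => v⁻¹) '' Ioo 0 1 = Ioi 1 := by
  ext u
  constructor
  · rintro ⟨v, hv, rfl⟩
    exact (one_lt_inv₀ hv.1).2 hv.2
  · intro hu
    have hu' : (1 : ℝ) < u := hu
    exact ⟨u⁻¹, ⟨by positivity, inv_lt_one_of_one_lt₀ hu'⟩, inv_inv u⟩

lemma hasDerivWithinAt_inv_Ioo (v : ℝ) (hv : v ∈ Ioo (0 : ℝ) 1) :
    HasDerivWithinAt (fun v : ℝ => v⁻¹) (-(v ^ 2)⁻¹) (Ioo 0 1) v :=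
  (hasDerivAt_inv hv.1.ne').hasDerivWithinAt

/-- The substitution `u = v⁻¹` carries `(1, ∞)` to `(0, 1)` and produces a beta integrand. -/
lemma abs_deriv_inv_smul {r β v : ℝ} (hv : v ∈ Ioo (0 : ℝ) 1) :
    |-(v ^ 2)⁻¹| • ((v⁻¹ - 1) ^ (r - 1) * (v⁻¹) ^ (-β))
      = v ^ (β - r - 1) * (1 - v) ^ (r - 1) := by
  have hv0 := hv.1
  have h1 : (0 : ℝ) ≤ 1 - v := by linarith [hv.2]
  have e1 : v⁻¹ - 1 = v⁻¹ * (1 - v) := by field_simp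
  have e2 : |-(v ^ 2)⁻¹| = v ^ (-2 : ℝ) := by
    rw [abs_neg, abs_of_pos (by positivity), Real.rpow_neg hv0.le, Real.rpow_two]
  rw [e1, e2, Real.mul_rpow (by positivity) h1, ← Real.rpow_neg_one v, ← Real.rpow_mul hv0.le,
    ← Real.rpow_mul hv0.le, smul_eq_mul,
    show β - r - 1 = -2 + -1 * (r - 1) + -1 * -β by ring, Real.rpow_add hv0, Real.rpow_add hv0]
  ring

lemma integrableOn_sub_one_rpow_mul {β r : ℝ} (hr : 0 < r) (hrβ : r < β) :
    IntegrableOn (fun u : ℝ => (u - 1) ^ (r - 1) * u ^ (-β)) (Ioi 1) := by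
  rw [← image_inv_Ioo_zero_one, integrableOn_image_iff_integrableOn_abs_deriv_smul
    measurableSet_Ioo hasDerivWithinAt_inv_Ioo inv_injective.injOn]
  exact (integrableOn_congr_fun (fun v hv => abs_deriv_inv_smul hv) measurableSet_Ioo).2
    (integrableOn_beta (by linarith) hr)

lemma integral_sub_one_rpow_mul {β r : ℝ} (hr : 0 < r) (hrβ : r < β) :
    ∫ u in Ioi (1 : ℝ), (u - 1) ^ (r - 1) * u ^ (-β) = beta (β - r) r := by
  rw [← image_inv_Ioo_zero_one, integral_image_eq_integral_abs_deriv_smul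
    measurableSet_Ioo hasDerivWithinAt_inv_Ioo inv_injective.injOn,
    ← integral_beta (by linarith) hr]
  exact setIntegral_congr_fun measurableSet_Ioo fun v hv => abs_deriv_inv_smul hv

/-- Linear vanishing at `u = 0` tames the singularity `u ^ (-β)` for `β < 2`. -/
lemma one_sub_rpow_mem {r u : ℝ} (hr : 0 < r) (hu : u ∈ Icc (0 : ℝ) 1) :
    1 - (1 - u) ^ r ∈ Icc 0 ((1 + r) * u) := by
  have h0 : (0 : ℝ) ≤ 1 - u := by linarith [hu.2]
  constructor
  · have := Real.rpow_le_one h0 (by linarith [hu.1]) hr.le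
    linarith
  · rcases le_total r 1 with h | h
    · have : 1 - u ≤ (1 - u) ^ r := by
        rcases h0.eq_or_lt with h1 | h1
        · rw [← h1]; positivity
        · calc 1 - u = (1 - u) ^ (1 : ℝ) := (Real.rpow_one _).symm
            _ ≤ _ := Real.rpow_le_rpow_of_exponent_ge h1 (by linarith [hu.1]) h
      nlinarith [hu.1]
    · have := one_add_mul_self_le_rpow_one_add (s := -u) (by linarith [hu.2]) h
      rw [← sub_eq_add_neg] at this
      nlinarith [hu.1]

lemma integrableOn_one_sub_rpow_mul {β r : ℝ} (hβ : β < 2) (hr : 0 < r) :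
    IntegrableOn (fun u : ℝ => (1 - (1 - u) ^ r) * u ^ (-β)) (Ioo 0 1) := by
  have h : IntegrableOn (fun u : ℝ => (1 + r) * u ^ (1 - β)) (Ioo 0 1) := by
    refine Integrable.const_mul ?_ _
    have := intervalIntegral.intervalIntegrable_rpow' (a := 0) (b := 1) (r := 1 - β) (by linarith)
    rwa [intervalIntegrable_iff_integrableOn_Ioo_of_le zero_le_one] at this
  refine Integrable.mono' h (by fun_prop) ?_
  filter_upwards [ae_restrict_mem measurableSet_Ioo] with u hu
  have h1 := one_sub_rpow_mem hr ⟨hu.1.le, hu.2.le⟩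
  rw [Real.norm_of_nonneg (mul_nonneg h1.1 (Real.rpow_nonneg hu.1.le _)),
    sub_eq_add_neg 1 β, Real.rpow_add hu.1, Real.rpow_one, ← mul_assoc]
  exact mul_le_mul_of_nonneg_right h1.2 (Real.rpow_nonneg hu.1.le _)

lemma integral_one_sub_rpow_mul {β r : ℝ} (hβ1 : 1 < β) (hβ : β < 2) (hr : 0 < r) :
    ∫ u in Ioo (0 : ℝ) 1, (1 - (1 - u) ^ r) * u ^ (-β)
      = (r * beta (2 - β) r - 1) / (β - 1) := by
  have hβ0 : 1 - β ≠ 0 := by linarith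
  have hint2 : IntegrableOn (fun u : ℝ => r / (1 - β) * (u ^ (2 - β - 1) * (1 - u) ^ (r - 1)))
      (Ioo 0 1) := (integrableOn_beta (by linarith) hr).const_mul _
  have hint1 := integrableOn_one_sub_rpow_mul hβ hr
  -- Integration by parts against `u ^ (1-β) / (1-β)`. Only one-sided limits at the endpoints are
  -- used, since the integrand may be singular at both.
  have hFTC := intervalIntegral.integral_eq_sub_of_hasDerivAt_of_tendsto (a := 0) (b := 1)
    (f := fun u : ℝ => (1 - (1 - u) ^ r) * u ^ (1 - β) / (1 - β))
    (f' := fun u : ℝ => r / (1 - β) * (u ^ (2 - β - 1) * (1 - u) ^ (r - 1))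
      + (1 - (1 - u) ^ r) * u ^ (-β)) (fa := 0) (fb := 1 / (1 - β)) zero_lt_one ?_ ?_ ?_ ?_
  · rw [intervalIntegral.integral_of_le zero_le_one, integral_Ioc_eq_integral_Ioo,
      integral_add hint2 hint1, integral_const_mul, integral_beta (by linarith) hr] at hFTC
    have : β - 1 ≠ 0 := by linarith
    rw [eq_div_iff this]
    field_simp at hFTC
    linarith
  · intro u hu
    have h1 : (1 : ℝ) - u ≠ 0 := by linarith [hu.2]
    have d1 : HasDerivAt (fun u : ℝ => 1 - (1 - u) ^ r) (r * (1 - u) ^ (r - 1)) u := by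
      have := ((hasDerivAt_id u).const_sub 1).rpow_const (p := r) (Or.inl h1)
      exact (this.const_sub 1).congr_deriv (by simp)
    have d2 : HasDerivAt (fun u : ℝ => u ^ (1 - β)) ((1 - β) * u ^ (-β)) u := by
      convert Real.hasDerivAt_rpow_const (p := 1 - β) (Or.inl hu.1.ne') using 3
      ring
    refine ((d1.mul d2).div_const (1 - β)).congr_deriv ?_
    rw [show 2 - β - 1 = 1 - β by ring]
    field_simp
  · rw [intervalIntegrable_iff_integrableOn_Ioo_of_le zero_le_one]
    exact hint2.add hint1
  · have hb : Tendsto (fun u : ℝ => (1 + r) * u ^ (2 - β) / (β - 1)) (𝓝[>] 0) (𝓝 0) := by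
      have h0 : ContinuousAt (fun u : ℝ => (1 + r) * u ^ (2 - β) / (β - 1)) 0 :=
        ((Real.continuousAt_rpow_const 0 (2 - β) (Or.inr (by linarith))).const_mul _).div_const _
      have := h0.tendsto
      rw [Real.zero_rpow (by linarith), mul_zero, zero_div] at this
      exact this.mono_left nhdsWithin_le_nhds
    refine squeeze_zero_norm' ?_ hb
    filter_upwards [Ioo_mem_nhdsGT (zero_lt_one' ℝ)] with u hu
    have h1 := one_sub_rpow_mem hr ⟨hu.1.le, hu.2.le⟩
    have hup := Real.rpow_nonneg hu.1.le (1 - β)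
    rw [norm_div, norm_mul, Real.norm_of_nonneg h1.1, Real.norm_of_nonneg hup, Real.norm_eq_abs,
      abs_of_neg (by linarith), neg_sub, show 2 - β = 1 + (1 - β) by ring, Real.rpow_add hu.1,
      Real.rpow_one, ← mul_assoc]
    exact div_le_div_of_nonneg_right (mul_le_mul_of_nonneg_right h1.2 hup) (by linarith)
  · have h0 : ContinuousAt (fun u : ℝ => (1 - (1 - u) ^ r) * u ^ (1 - β) / (1 - β)) 1 := by
      have c1 : ContinuousAt (fun u : ℝ => (1 - u) ^ r) 1 :=
        ContinuousAt.rpow_const (by fun_prop) (Or.inr hr.le)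
      exact ((continuousAt_const.sub c1).mul
        (Real.continuousAt_rpow_const 1 (1 - β) (Or.inl one_ne_zero))).div_const _
    have := h0.tendsto
    rw [sub_self, Real.zero_rpow hr.ne', sub_zero, Real.one_rpow, one_mul] at this
    exact this.mono_left nhdsWithin_le_nhds

/-! ### The tail drift constant and its root -/

/-- `stepProfile r u` is `r⁻¹` times the derivative of `|1 - u| ^ r + r u`. -/
noncomputable def stepProfile (r u : ℝ) : ℝ :=
  if u < 1 then 1 - (1 - u) ^ (r - 1) else 1 + (u - 1) ^ (r - 1)

/-- The drift constant produced by an inward tail `c y ^ (-β)` for the Lyapunov function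
`|x| ^ r`. -/
noncomputable def tailDrift (β r : ℝ) : ℝ := ∫ u in Ioi (0 : ℝ), stepProfile r u * u ^ (-β)

@[fun_prop]
lemma measurable_stepProfile (r : ℝ) : Measurable (stepProfile r) :=
  Measurable.ite measurableSet_Iio (by fun_prop) (by fun_prop)

/-- Trading the exponent `r - 1`, possibly negative, for `r` separates the singularities at `0` and
`1` into two integrable pieces. -/
lemma stepProfile_mul_eq_left {β r u : ℝ} (hu : u ∈ Ioo (0 : ℝ) 1) :
    stepProfile r u * u ^ (-β)
      = (1 - (1 - u) ^ r) * u ^ (-β) - u ^ (2 - β - 1) * (1 - u) ^ (r - 1) := by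
  have h1 : (0 : ℝ) < 1 - u := by linarith [hu.2]
  have e1 : (1 - u) ^ r = (1 - u) * (1 - u) ^ (r - 1) := by
    rw [Real.rpow_sub_one h1.ne']; field_simp
  have e2 : u ^ (2 - β - 1) = u * u ^ (-β) := by
    rw [show 2 - β - 1 = 1 + -β by ring, Real.rpow_add hu.1, Real.rpow_one]
  rw [stepProfile, if_pos hu.2, e1, e2]
  ring

lemma integrableOn_stepProfile_left {β r : ℝ} (hβ : β < 2) (hr : 0 < r) :
    IntegrableOn (fun u : ℝ => stepProfile r u * u ^ (-β)) (Ioo 0 1) :=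
  (integrableOn_congr_fun (fun _ hu => stepProfile_mul_eq_left hu) measurableSet_Ioo).2
    ((integrableOn_one_sub_rpow_mul hβ hr).sub (integrableOn_beta (by linarith) hr))

lemma stepProfile_mul_eq_right {β r u : ℝ} (hu : u ∈ Ioi (1 : ℝ)) :
    stepProfile r u * u ^ (-β) = u ^ (-β) + (u - 1) ^ (r - 1) * u ^ (-β) := by
  rw [stepProfile, if_neg (not_lt.2 (le_of_lt hu))]
  ring

lemma integrableOn_stepProfile_right {β r : ℝ} (hβ1 : 1 < β) (hr : 0 < r) (hrβ : r < β) :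
    IntegrableOn (fun u : ℝ => stepProfile r u * u ^ (-β)) (Ioi 1) :=
  (integrableOn_congr_fun (fun _ hu => stepProfile_mul_eq_right hu) measurableSet_Ioi).2
    ((integrableOn_Ioi_rpow_of_lt (by linarith) zero_lt_one).add
      (integrableOn_sub_one_rpow_mul hr hrβ))

lemma integrableOn_stepProfile {β r : ℝ} (hβ1 : 1 < β) (hβ : β < 2) (hr : 0 < r) (hrβ : r < β) :
    IntegrableOn (fun u : ℝ => stepProfile r u * u ^ (-β)) (Ioi 0) := by
  rw [← Ioc_union_Ioi_eq_Ioi zero_le_one]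
  refine IntegrableOn.union ?_ (integrableOn_stepProfile_right hβ1 hr hrβ)
  rw [integrableOn_Ioc_iff_integrableOn_Ioo]
  exact integrableOn_stepProfile_left hβ hr

lemma tailDrift_eq_add {β r : ℝ} (hβ1 : 1 < β) (hβ : β < 2) (hr : 0 < r) (hrβ : r < β) :
    tailDrift β r = (∫ u in Ioo (0 : ℝ) 1, stepProfile r u * u ^ (-β))
      + ∫ u in Ioi (1 : ℝ), stepProfile r u * u ^ (-β) := by
  rw [tailDrift, ← Ioc_union_Ioi_eq_Ioi zero_le_one, setIntegral_union
    (Ioc_disjoint_Ioi le_rfl) measurableSet_Ioi _ (integrableOn_stepProfile_right hβ1 hr hrβ),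
    integral_Ioc_eq_integral_Ioo]
  rw [integrableOn_Ioc_iff_integrableOn_Ioo]
  exact integrableOn_stepProfile_left hβ hr

lemma tailDrift_eq {β r : ℝ} (hβ1 : 1 < β) (hβ : β < 2) (hr : 0 < r) (hrβ : r < β) :
    tailDrift β r = (r - (β - 1)) / (β - 1) * beta (2 - β) r + beta (β - r) r := by
  rw [tailDrift_eq_add hβ1 hβ hr hrβ,
    setIntegral_congr_fun measurableSet_Ioo fun u hu => stepProfile_mul_eq_left hu,
    setIntegral_congr_fun measurableSet_Ioi fun u hu => stepProfile_mul_eq_right hu,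
    integral_sub (integrableOn_one_sub_rpow_mul hβ hr) (integrableOn_beta (by linarith) hr),
    integral_add (integrableOn_Ioi_rpow_of_lt (by linarith) zero_lt_one)
      (integrableOn_sub_one_rpow_mul hr hrβ),
    integral_one_sub_rpow_mul hβ1 hβ hr, integral_beta (by linarith) hr,
    integral_sub_one_rpow_mul hr hrβ, integral_Ioi_rpow_of_lt (by linarith) zero_lt_one]
  have : β - 1 ≠ 0 := by linarith
  have : -β + 1 ≠ 0 := by linarith
  rw [Real.one_rpow]
  field_simp
  ring

/-- Since `Γ(2-β) = (1-β) Γ(1-β)`, the Gamma expression in the critical equation is `-tailDrift β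
ν`. -/
lemma criticalEq_iff {β b c ν : ℝ} (hβ1 : 1 < β) (hβ : β < 2) (hc : 0 < c) (hν : 0 < ν)
    (hνβ : ν < β) : CriticalEq β b c ν ↔ b + c * tailDrift β ν = 0 := by
  have hβ0 : 1 - β ≠ 0 := by linarith
  have hβ0' : β - 1 ≠ 0 := by linarith
  have e1 : Real.Gamma (2 - β) = (1 - β) * Real.Gamma (1 - β) := by
    rw [← Real.Gamma_add_one hβ0]; ring_nf
  have g1 := (Real.Gamma_pos_of_pos (show 0 < 2 - β + ν by linarith)).ne'
  have g2 := (Real.Gamma_pos_of_pos (show 0 < β by linarith)).ne'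
  have e : Real.Gamma ν * ((1 - β + ν) * Real.Gamma (1 - β) / Real.Gamma (2 - β + ν)
      - Real.Gamma (β - ν) / Real.Gamma β) = -tailDrift β ν := by
    rw [tailDrift_eq hβ1 hβ hν hνβ, beta, beta, e1, sub_add_cancel]
    field_simp
    ring
  rw [CriticalEq, e, div_eq_iff hc.ne']
  constructor <;> intro h <;> linarith

/-- Raising the exponent increases the profile on `(0, 1)` and beyond `2`, but decreases it on `(1,
2)`. The reflection `u ↦ 2 - u` pairs the two unit intervals with opposite differences, and the gain
wins because `u ^ (-β) > (2 - u) ^ (-β)` on `(0, 1)`. -/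
lemma tailDrift_strictMono {β r s : ℝ} (hβ1 : 1 < β) (hβ : β < 2) (hr : 0 < r) (hrs : r < s)
    (hsβ : s < β) : tailDrift β r < tailDrift β s := by
  have hs : 0 < s := hr.trans hrs
  have hrβ := hrs.trans hsβ
  rw [tailDrift_eq_add hβ1 hβ hr hrβ, tailDrift_eq_add hβ1 hβ hs hsβ]
  set d : ℝ → ℝ := fun u => stepProfile s u * u ^ (-β) - stepProfile r u * u ^ (-β) with hd
  have iL : IntegrableOn d (Ioo 0 1) :=
    (integrableOn_stepProfile_left hβ hs).sub (integrableOn_stepProfile_left hβ hr)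
  have iR : IntegrableOn d (Ioi 1) :=
    (integrableOn_stepProfile_right hβ1 hs hsβ).sub (integrableOn_stepProfile_right hβ1 hr hrβ)
  have eL : ∫ u in Ioo (0 : ℝ) 1, d u = (∫ u in Ioo (0 : ℝ) 1, stepProfile s u * u ^ (-β))
      - ∫ u in Ioo (0 : ℝ) 1, stepProfile r u * u ^ (-β) :=
    integral_sub (integrableOn_stepProfile_left hβ hs) (integrableOn_stepProfile_left hβ hr)
  have eR : ∫ u in Ioi (1 : ℝ), d u = (∫ u in Ioi (1 : ℝ), stepProfile s u * u ^ (-β))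
      - ∫ u in Ioi (1 : ℝ), stepProfile r u * u ^ (-β) :=
    integral_sub (integrableOn_stepProfile_right hβ1 hs hsβ)
      (integrableOn_stepProfile_right hβ1 hr hrβ)
  suffices 0 < (∫ u in Ioo (0 : ℝ) 1, d u) + ∫ u in Ioi (1 : ℝ), d u by linarith
  have i12 : IntegrableOn d (Ioc 1 2) := iR.mono_set Ioc_subset_Ioi_self
  have i2 : IntegrableOn d (Ioi 2) := iR.mono_set (Ioi_subset_Ioi one_le_two)
  have hsplit : ∫ u in Ioi (1 : ℝ), d u = (∫ u in Ioc (1 : ℝ) 2, d u) + ∫ u in Ioi (2 : ℝ), d u := by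
    rw [← Ioc_union_Ioi_eq_Ioi one_le_two,
      setIntegral_union (Ioc_disjoint_Ioi le_rfl) measurableSet_Ioi i12 i2]
  have dR : ∀ u : ℝ, 1 ≤ u → d u = ((u - 1) ^ (s - 1) - (u - 1) ^ (r - 1)) * u ^ (-β) := by
    intro u hu
    simp only [hd, stepProfile, if_neg (not_lt.2 hu)]
    ring
  have dL : ∀ u : ℝ, u < 1 → d u = ((1 - u) ^ (r - 1) - (1 - u) ^ (s - 1)) * u ^ (-β) := by
    intro u hu
    simp only [hd, stepProfile, if_pos hu]
    ring
  have h2 : 0 ≤ ∫ u in Ioi (2 : ℝ), d u := by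
    refine setIntegral_nonneg measurableSet_Ioi fun u hu => ?_
    have hu' : (2 : ℝ) < u := hu
    rw [dR u (by linarith)]
    have : (u - 1) ^ (r - 1) ≤ (u - 1) ^ (s - 1) :=
      Real.rpow_le_rpow_of_exponent_le (by linarith) (by linarith)
    have : 0 ≤ u ^ (-β) := by positivity
    nlinarith
  have j12 : IntervalIntegrable d volume 1 2 :=
    (intervalIntegrable_iff_integrableOn_Ioc_of_le one_le_two).2 i12
  have j01 : IntervalIntegrable d volume 0 1 :=
    (intervalIntegrable_iff_integrableOn_Ioo_of_le zero_le_one).2 iL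
  have jrefl : IntervalIntegrable (fun u => d (2 - u)) volume 0 1 := by
    have := j12.comp_sub_left 2
    norm_num at this
    exact this.symm
  have hrefl : ∫ u in Ioc (1 : ℝ) 2, d u = ∫ u in (0 : ℝ)..1, d (2 - u) := by
    rw [intervalIntegral.integral_comp_sub_left, ← intervalIntegral.integral_of_le one_le_two]
    norm_num
  rw [hsplit, hrefl, ← integral_Ioc_eq_integral_Ioo,
    ← intervalIntegral.integral_of_le zero_le_one, ← add_assoc,
    ← intervalIntegral.integral_add j01 jrefl]
  refine add_pos_of_pos_of_nonneg ?_ h2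
  refine intervalIntegral.intervalIntegral_pos_of_pos_on (j01.add jrefl) (fun u hu => ?_)
    zero_lt_one
  have h1 : (0 : ℝ) < 1 - u := by linarith [hu.2]
  rw [dL u hu.2, dR (2 - u) (by linarith [hu.2]), show 2 - u - 1 = 1 - u by ring]
  have m1 : (1 - u) ^ (s - 1) < (1 - u) ^ (r - 1) :=
    Real.rpow_lt_rpow_of_exponent_gt h1 (by linarith [hu.1]) (by linarith)
  have m2 : (2 - u) ^ (-β) < u ^ (-β) :=
    Real.rpow_lt_rpow_of_neg hu.1 (by linarith [hu.2]) (by linarith)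
  nlinarith

lemma differentiableAt_Gamma_of_pos {s : ℝ} (hs : 0 < s) : DifferentiableAt ℝ Real.Gamma s :=
  Real.differentiableAt_Gamma fun m => by
    have : (0 : ℝ) ≤ m := m.cast_nonneg
    linarith

lemma tailDrift_eq_Gamma {β r : ℝ} (hβ1 : 1 < β) (hβ : β < 2) (hr : 0 < r) (hrβ : r < β) :
    tailDrift β r = Real.Gamma r * (Real.Gamma (β - r) / Real.Gamma β
      + (r - (β - 1)) / (β - 1) * (Real.Gamma (2 - β) / Real.Gamma (2 - β + r))) := by
  rw [tailDrift_eq hβ1 hβ hr hrβ, beta, beta, sub_add_cancel]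
  ring

lemma continuousOn_tailDrift {β : ℝ} (hβ1 : 1 < β) (hβ : β < 2) :
    ContinuousOn (tailDrift β) (Ioo 0 β) := by
  refine ContinuousOn.congr ?_ fun r hr => tailDrift_eq_Gamma hβ1 hβ hr.1 hr.2
  intro r hr
  have hr0 := hr.1
  have hrβ := hr.2
  have c1 := (differentiableAt_Gamma_of_pos hr0).continuousAt
  have c2 : ContinuousAt (fun r => Real.Gamma (β - r)) r :=
    ContinuousAt.comp' (f := fun r => β - r)
      (differentiableAt_Gamma_of_pos (by linarith)).continuousAt (by fun_prop)
  have c3 : ContinuousAt (fun r => Real.Gamma (2 - β + r)) r :=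
    ContinuousAt.comp' (f := fun r => 2 - β + r)
      (differentiableAt_Gamma_of_pos (by linarith)).continuousAt (by fun_prop)
  have g := (Real.Gamma_pos_of_pos (show 0 < 2 - β + r by linarith)).ne'
  refine ContinuousAt.continuousWithinAt ?_
  exact c1.mul ((c2.div_const _).add (ContinuousAt.mul (by fun_prop)
    (continuousAt_const.div c3 g)))

/-- The divergence is the pole of `Γ(β - r)` at `r = β`; the other term stays bounded. -/
lemma tendsto_tailDrift_right {β : ℝ} (hβ1 : 1 < β) (hβ : β < 2) :
    Tendsto (tailDrift β) (𝓝[<] β) atTop := by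
  have hG : Tendsto (fun r => Real.Gamma (β - r)) (𝓝[<] β) atTop := by
    have t1 : Tendsto (fun r => Real.Gamma (β - r + 1)) (𝓝[<] β) (𝓝 1) := by
      have c : ContinuousAt (fun r => Real.Gamma (β - r + 1)) β :=
        ContinuousAt.comp' (f := fun r => β - r + 1)
          (differentiableAt_Gamma_of_pos (by linarith)).continuousAt (by fun_prop)
      have := c.tendsto
      simp only [sub_self, zero_add, Real.Gamma_one] at this
      exact this.mono_left nhdsWithin_le_nhds
    have t2 : Tendsto (fun r => (β - r)⁻¹) (𝓝[<] β) atTop := by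
      refine tendsto_inv_nhdsGT_zero.comp (tendsto_nhdsWithin_iff.2 ⟨?_, ?_⟩)
      · have : Tendsto (fun r => β - r) (𝓝 β) (𝓝 (β - β)) := by
          exact (continuous_const.sub continuous_id).tendsto β
        rw [sub_self] at this
        exact this.mono_left nhdsWithin_le_nhds
      · filter_upwards [self_mem_nhdsWithin] with r hr
        exact mem_Ioi.2 (sub_pos.2 (mem_Iio.1 hr))
    refine (Tendsto.atTop_mul_pos one_pos t2 t1).congr' ?_
    filter_upwards [self_mem_nhdsWithin] with r hr
    have : β - r ≠ 0 := (sub_pos.2 (mem_Iio.1 hr)).ne'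
    rw [Real.Gamma_add_one this]
    field_simp
  have g2 := Real.Gamma_pos_of_pos (show 0 < β by linarith)
  have c1 : Tendsto Real.Gamma (𝓝[<] β) (𝓝 (Real.Gamma β)) :=
    (differentiableAt_Gamma_of_pos (by linarith)).continuousAt.tendsto.mono_left nhdsWithin_le_nhds
  have c3 : Tendsto (fun r => (r - (β - 1)) / (β - 1) * (Real.Gamma (2 - β) / Real.Gamma (2 - β + r)))
      (𝓝[<] β) (𝓝 ((β - (β - 1)) / (β - 1) * (Real.Gamma (2 - β) / Real.Gamma (2 - β + β)))) := by
    have c3 : ContinuousAt (fun r => Real.Gamma (2 - β + r)) β :=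
      ContinuousAt.comp' (f := fun r => 2 - β + r)
        (differentiableAt_Gamma_of_pos (by linarith)).continuousAt (by fun_prop)
    have g := (Real.Gamma_pos_of_pos (show 0 < 2 - β + β by linarith)).ne'
    have : ContinuousAt (fun r => (r - (β - 1)) / (β - 1)
      * (Real.Gamma (2 - β) / Real.Gamma (2 - β + r))) β :=
      ContinuousAt.mul (by fun_prop) (continuousAt_const.div c3 g)
    exact this.tendsto.mono_left nhdsWithin_le_nhds
  refine (Tendsto.pos_mul_atTop g2 c1 ((hG.atTop_div_const g2).atTop_add c3)).congr' ?_
  filter_upwards [Ioo_mem_nhdsLT (show (0 : ℝ) < β by linarith)] with r hr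
  rw [tailDrift_eq_Gamma hβ1 hβ hr.1 hr.2]

/-- Differentiate the reflection formula in the form `Γ(s) Γ(2-s) = (1-s) π / sin (π s)` at `s = β`,
then divide by the product. -/
lemma deriv_Gamma_reflection {β : ℝ} (hβ1 : 1 < β) (hβ : β < 2) :
    deriv Real.Gamma (2 - β) / Real.Gamma (2 - β) - deriv Real.Gamma β / Real.Gamma β
      + 1 / (β - 1) = Real.pi * Real.cot (Real.pi * β) := by
  have hβ0 : 1 - β ≠ 0 := by linarith
  have hβ0' : β - 1 ≠ 0 := by linarith
  have hsin : Real.sin (Real.pi * β) ≠ 0 := by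
    have : Real.sin (Real.pi * β) = -Real.sin (Real.pi * β - Real.pi) := by
      rw [Real.sin_sub_pi, neg_neg]
    rw [this, neg_ne_zero]
    refine (Real.sin_pos_of_pos_of_lt_pi ?_ ?_).ne' <;> nlinarith [Real.pi_pos]
  have d1 := (differentiableAt_Gamma_of_pos (show 0 < β by linarith)).hasDerivAt
  have d2 := (differentiableAt_Gamma_of_pos (show 0 < 2 - β by linarith)).hasDerivAt
  have d3 : HasDerivAt (fun s => Real.Gamma (2 - s)) (-deriv Real.Gamma (2 - β)) β := by
    have := HasDerivAt.comp (h := fun s => 2 - s) β d2 ((hasDerivAt_id β).const_sub 2)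
    simpa [Function.comp_def] using this
  have dL := d1.mul d3
  have e : ∀ s : ℝ, s ≠ 1 → Real.Gamma s * Real.Gamma (2 - s)
      = (1 - s) * Real.pi / Real.sin (Real.pi * s) := by
    intro s hs
    have h1 : Real.Gamma (2 - s) = (1 - s) * Real.Gamma (1 - s) := by
      rw [← Real.Gamma_add_one (sub_ne_zero.2 hs.symm)]; ring_nf
    rw [h1, mul_left_comm, Real.Gamma_mul_Gamma_one_sub]
    ring
  have dR : HasDerivAt (fun s => (1 - s) * Real.pi / Real.sin (Real.pi * s))
      ((-Real.pi * Real.sin (Real.pi * β)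
        - (1 - β) * Real.pi * (Real.cos (Real.pi * β) * Real.pi)) / Real.sin (Real.pi * β) ^ 2)
      β := by
    have n1 : HasDerivAt (fun s : ℝ => (1 - s) * Real.pi) (-Real.pi) β := by
      simpa using ((hasDerivAt_id β).const_sub 1).mul_const Real.pi
    have n2 : HasDerivAt (fun s : ℝ => Real.sin (Real.pi * s))
        (Real.cos (Real.pi * β) * Real.pi) β := by
      simpa using ((hasDerivAt_id β).const_mul Real.pi).sin
    exact n1.div n2 hsin
  have heq : (Real.Gamma * fun s => Real.Gamma (2 - s))
      =ᶠ[𝓝 β] fun s => (1 - s) * Real.pi / Real.sin (Real.pi * s) := by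
    filter_upwards [lt_mem_nhds hβ1] with s hs
    exact e s hs.ne'
  have key := (dL.congr_of_eventuallyEq heq.symm).unique dR
  have hG := e β hβ1.ne'
  have g1 := (Real.Gamma_pos_of_pos (show 0 < 2 - β by linarith)).ne'
  have g2 := (Real.Gamma_pos_of_pos (show 0 < β by linarith)).ne'
  rw [Real.cot_eq_cos_div_sin]
  have hpi := Real.pi_ne_zero
  have lhs : deriv Real.Gamma (2 - β) / Real.Gamma (2 - β) - deriv Real.Gamma β / Real.Gamma β
      = -(deriv Real.Gamma β * Real.Gamma (2 - β) + Real.Gamma β * -deriv Real.Gamma (2 - β))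
        / (Real.Gamma β * Real.Gamma (2 - β)) := by
    field_simp
    ring
  rw [lhs, key, hG]
  field_simp
  ring

/-- The bracket multiplying `Γ(r)` vanishes at `r = 0` and cancels the pole. As `r Γ(r) → 1`, the
limit is the derivative of the bracket at `0`. -/
lemma tendsto_tailDrift_zero {β : ℝ} (hβ1 : 1 < β) (hβ : β < 2) :
    Tendsto (tailDrift β) (𝓝[>] 0) (𝓝 (Real.pi * Real.cot (Real.pi * β))) := by
  have hβ0' : β - 1 ≠ 0 := by linarith
  have g1 := (Real.Gamma_pos_of_pos (show 0 < 2 - β by linarith)).ne'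
  have g2 := (Real.Gamma_pos_of_pos (show 0 < β by linarith)).ne'
  set A : ℝ → ℝ := fun r => Real.Gamma (β - r) / Real.Gamma β
      + (r - (β - 1)) / (β - 1) * (Real.Gamma (2 - β) / Real.Gamma (2 - β + r)) with hA
  have hA0 : A 0 = 0 := by
    simp only [hA, sub_zero, add_zero, zero_sub]
    field_simp
    ring
  have d1 : HasDerivAt (fun r => Real.Gamma (β - r)) (-deriv Real.Gamma β) 0 := by
    have h := (differentiableAt_Gamma_of_pos (show 0 < β - 0 by linarith)).hasDerivAt
    have := HasDerivAt.comp (h := fun s => β - s) 0 h ((hasDerivAt_id 0).const_sub β)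
    simpa [Function.comp_def] using this
  have d2 : HasDerivAt (fun r => Real.Gamma (2 - β + r)) (deriv Real.Gamma (2 - β)) 0 := by
    have h := (differentiableAt_Gamma_of_pos (show 0 < 2 - β + 0 by linarith)).hasDerivAt
    have := HasDerivAt.comp (h := fun s => 2 - β + s) 0 h ((hasDerivAt_id 0).const_add (2 - β))
    simpa [Function.comp_def] using this
  have d3 : HasDerivAt (fun r : ℝ => (r - (β - 1)) / (β - 1)) (1 / (β - 1)) 0 :=
    ((hasDerivAt_id 0).sub_const _).div_const _
  have d4 : HasDerivAt (fun r => Real.Gamma (2 - β) / Real.Gamma (2 - β + r))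
      (-deriv Real.Gamma (2 - β) / Real.Gamma (2 - β)) 0 := by
    have := (hasDerivAt_const (0 : ℝ) (Real.Gamma (2 - β))).div d2 (by simpa using g1)
    refine this.congr_deriv ?_
    simp only [add_zero]
    field_simp
    ring
  have dA : HasDerivAt A (Real.pi * Real.cot (Real.pi * β)) 0 := by
    rw [← deriv_Gamma_reflection hβ1 hβ]
    refine ((d1.div_const (Real.Gamma β)).add (d3.mul d4)).congr_deriv ?_
    simp only [add_zero, zero_sub]
    field_simp
    ring
  have hslope := (hasDerivAt_iff_tendsto_slope.1 dA).mono_left (nhdsGT_le_nhdsNE (0 : ℝ))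
  have tG : Tendsto (fun r => Real.Gamma (r + 1)) (𝓝[>] 0) (𝓝 1) := by
    have c : ContinuousAt (fun r => Real.Gamma (r + 1)) 0 :=
      ContinuousAt.comp' (f := fun r => r + 1)
        (differentiableAt_Gamma_of_pos (by linarith)).continuousAt (by fun_prop)
    have := c.tendsto
    simp only [zero_add, Real.Gamma_one] at this
    exact this.mono_left nhdsWithin_le_nhds
  have := tG.mul hslope
  rw [one_mul] at this
  refine this.congr' ?_
  filter_upwards [Ioo_mem_nhdsGT (show (0 : ℝ) < β by linarith)] with r hr
  have hr0 := hr.1.ne'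
  rw [tailDrift_eq_Gamma hβ1 hβ hr.1 hr.2, slope_def_field, hA0, Real.Gamma_add_one hr0]
  simp only [hA]
  field_simp
  ring

/-- Existence of the critical exponent. -/
lemma exists_tailDrift_eq {β b c : ℝ} (hβ1 : 1 < β) (hβ : β < 2) (hc : 0 < c)
    (h : b + c * Real.pi * Real.cot (Real.pi * β) < 0) :
    ∃ ν ∈ Ioo 0 β, b + c * tailDrift β ν = 0 := by
  have hβ0 : 0 < β := by linarith
  have hlt : Real.pi * Real.cot (Real.pi * β) < -b / c := by
    rw [lt_div_iff₀ hc]; linarith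
  obtain ⟨ν₁, h1, hν₁⟩ := (((tendsto_tailDrift_zero hβ1 hβ).eventually_lt_const hlt).and
    (Ioo_mem_nhdsGT hβ0)).exists
  obtain ⟨ν₂, h2, hν₂⟩ := (((tendsto_tailDrift_right hβ1 hβ).eventually_ge_atTop (-b / c)).and
    (Ioo_mem_nhdsLT hβ0)).exists
  obtain ⟨ν, hν, hν'⟩ := isPreconnected_Ioo.intermediate_value hν₁ hν₂
    (continuousOn_tailDrift hβ1 hβ) ⟨h1.le, h2⟩
  refine ⟨ν, hν, ?_⟩
  rw [hν']
  field_simp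
  ring

/-- Without drift the critical exponent is `2 β - 3`. -/
lemma tailDrift_two_mul_sub_three {β : ℝ} (hβ1 : 3 / 2 < β) (hβ : β < 2) :
    tailDrift β (2 * β - 3) = 0 := by
  have h1 : Real.Gamma β = (β - 1) * Real.Gamma (β - 1) := by
    rw [← Real.Gamma_add_one (by linarith : β - 1 ≠ 0)]; ring_nf
  have h2 : Real.Gamma (3 - β) = (2 - β) * Real.Gamma (2 - β) := by
    rw [← Real.Gamma_add_one (by linarith : 2 - β ≠ 0)]; ring_nf
  have g := (Real.Gamma_pos_of_pos (show 0 < β - 1 by linarith)).ne'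
  have : β - 1 ≠ 0 := by linarith
  -- At this exponent the two terms of the bracket are `± (2-β) Γ(2-β) / Γ(β)`.
  rw [tailDrift_eq_Gamma (by linarith) hβ (by linarith) (by linarith), h1,
    show β - (2 * β - 3) = 3 - β by ring, h2, show 2 - β + (2 * β - 3) = β - 1 by ring,
    mul_eq_zero]
  right
  field_simp
  ring

/-! ### Power moments of a single jump law -/

lemma hasDerivAt_abs_rpow {r u : ℝ} (hu : u ≠ 1) :
    HasDerivAt (fun u : ℝ => |1 - u| ^ r + r * u) (r * stepProfile r u) u := by
  rcases lt_or_gt_of_ne hu with h | h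
  · have h1 : (1 : ℝ) - u ≠ 0 := by linarith
    have d := (((hasDerivAt_id u).const_sub 1).rpow_const (p := r) (Or.inl h1)).add
      ((hasDerivAt_id u).const_mul r)
    refine (d.congr_deriv ?_).congr_of_eventuallyEq ?_
    · simp only [stepProfile, if_pos h, id]; ring
    · filter_upwards [gt_mem_nhds h] with v hv
      simp [abs_of_pos (sub_pos.2 hv)]
  · have h1 : u - 1 ≠ 0 := by linarith
    have d := (((hasDerivAt_id u).sub_const 1).rpow_const (p := r) (Or.inl h1)).add
      ((hasDerivAt_id u).const_mul r)
    refine (d.congr_deriv ?_).congr_of_eventuallyEq ?_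
    · simp only [stepProfile, if_neg (not_lt.2 h.le), id]; ring
    · filter_upwards [lt_mem_nhds h] with v hv
      simp [abs_of_neg (sub_neg.2 hv)]

lemma integral_stepProfile {β r v : ℝ} (hβ1 : 1 < β) (hβ : β < 2) (hr : 0 < r) (hrβ : r < β)
    (hv : 0 ≤ v) : ∫ u in Ioo 0 v, r * stepProfile r u = |1 - v| ^ r - 1 + r * v := by
  -- On `(0, v]` the factor `u ^ β` is at most `v ^ β`, so the weighted integrability suffices.
  have hint : IntegrableOn (fun u => r * stepProfile r u) (Ioc 0 v) := by
    refine Integrable.const_mul ?_ _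
    have h := ((integrableOn_stepProfile hβ1 hβ hr hrβ).mono_set
      (Ioc_subset_Ioi_self : Ioc 0 v ⊆ Ioi 0)).norm.const_mul (v ^ β)
    refine Integrable.mono' h (by fun_prop) ?_
    filter_upwards [ae_restrict_mem measurableSet_Ioc] with u hu
    have e : stepProfile r u = u ^ β * (stepProfile r u * u ^ (-β)) := by
      rw [mul_left_comm, ← Real.rpow_add hu.1]; simp
    calc ‖stepProfile r u‖ = ‖u ^ β * (stepProfile r u * u ^ (-β))‖ := by rw [← e]
      _ = u ^ β * ‖stepProfile r u * u ^ (-β)‖ := by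
          rw [norm_mul, Real.norm_of_nonneg (Real.rpow_nonneg hu.1.le _)]
      _ ≤ _ := by
          gcongr
          · exact hu.1.le
          · exact hu.2
  have h := MeasureTheory.integral_eq_of_hasDerivAt_off_countable_of_le
    (fun u : ℝ => |1 - u| ^ r + r * u) (fun u => r * stepProfile r u) hv (countable_singleton 1)
    ?_ (fun u hu => hasDerivAt_abs_rpow hu.2)
    ((intervalIntegrable_iff_integrableOn_Ioc_of_le hv).2 hint)
  · rw [intervalIntegral.integral_of_le hv, integral_Ioc_eq_integral_Ioo] at h
    rw [h]
    simp
    ring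
  · refine Continuous.continuousOn ?_
    exact (Continuous.rpow_const (by fun_prop) fun _ => Or.inr hr.le).add (by fun_prop)

/-- The remainder is quadratic for `v ≤ 1`, and of order at most `v ^ max r 1` for `v ≥ 1`. Any `s`
between `max r 1` and `2` covers both ranges, and `s = min α 2` is used later. -/
lemma abs_one_add_rpow_sub_le {r s v : ℝ} (hr : 0 < r) (hrs : r ≤ s) (hs1 : 1 ≤ s) (hs2 : s ≤ 2)
    (hv : 0 ≤ v) : |(1 + v) ^ r - 1 - r * v| ≤ 4 * v ^ s := by
  rcases hv.eq_or_lt with rfl | hv0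
  · simp [Real.zero_rpow (show s ≠ 0 by linarith)]
  have hsmall : v ≤ 1 → v ^ 2 ≤ v ^ s := fun h => by
    rw [← Real.rpow_two]; exact Real.rpow_le_rpow_of_exponent_ge hv0 h hs2
  have hlarge : ∀ t : ℝ, t ≤ s → 1 ≤ v → v ^ t ≤ v ^ s := fun t ht h =>
    Real.rpow_le_rpow_of_exponent_le h ht
  have h1v : (1 : ℝ) + v ≠ 0 := by linarith
  rcases le_or_gt r 1 with h | h
  · have up := rpow_one_add_le_one_add_mul_self (s := v) (by linarith) hr.le h
    have h2 := rpow_one_add_le_one_add_mul_self (s := v) (p := 1 - r) (by linarith) (by linarith)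
      (by linarith)
    have e : (1 + v) ^ r * (1 + v) ^ (1 - r) = 1 + v := by
      rw [← Real.rpow_add (by linarith)]; simp
    have hpos : 0 < (1 + v) ^ r := by positivity
    have h3 : 1 + v ≤ (1 + v) ^ r * (1 + (1 - r) * v) :=
      e.symm.le.trans (mul_le_mul_of_nonneg_left h2 hpos.le)
    have hone : 1 ≤ (1 + v) ^ r := Real.one_le_rpow (by linarith) hr.le
    rw [abs_le]
    constructor
    · rcases le_total v 1 with hv1 | hv1
      · have := hsmall hv1
        nlinarith [mul_nonneg (sub_nonneg.2 h) hv]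
      · have := hlarge 1 hs1 hv1
        rw [Real.rpow_one] at this
        nlinarith
    · have : 0 ≤ v ^ s := by positivity
      linarith
  · have lo := one_add_mul_self_le_rpow_one_add (s := v) (by linarith) h.le
    rw [abs_of_nonneg (by linarith)]
    rcases le_total v 1 with hv1 | hv1
    · have h2 := rpow_one_add_le_one_add_mul_self (s := v) (p := r - 1) (by linarith)
        (by linarith) (by linarith)
      have e : (1 + v) ^ r = (1 + v) * (1 + v) ^ (r - 1) := by
        rw [Real.rpow_sub_one h1v]; field_simp
      have := hsmall hv1
      rw [e]
      nlinarith
    · have h2 : (1 + v) ^ r ≤ (2 * v) ^ r :=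
        Real.rpow_le_rpow (by linarith) (by linarith) hr.le
      rw [Real.mul_rpow (by norm_num) hv] at h2
      have h3 : (2 : ℝ) ^ r ≤ 4 := by
        calc (2 : ℝ) ^ r ≤ 2 ^ (2 : ℝ) :=
              Real.rpow_le_rpow_of_exponent_le (by norm_num) (by linarith)
          _ = 4 := by norm_num
      have h4 := hlarge r hrs hv1
      have h5 : 0 ≤ v ^ r := by positivity
      nlinarith

lemma integrable_negPart_rpow {m : Measure ℝ} {α M : ℝ}
    (hM : ∫⁻ w, ENNReal.ofReal (w⁻ ^ α) ∂m ≤ ENNReal.ofReal M) :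
    Integrable (fun w : ℝ => w⁻ ^ α) m := by
  refine ⟨Measurable.aestronglyMeasurable (Measurable.pow_const (by fun_prop) _), ?_⟩
  rw [hasFiniteIntegral_iff_ofReal (Eventually.of_forall fun w =>
    Real.rpow_nonneg (negPart_nonneg w) _)]
  exact hM.trans_lt ENNReal.ofReal_lt_top

section Jump

variable {m : Measure ℝ} [IsProbabilityMeasure m] {α β r x K M : ℝ}

/-- Integration by parts in the form of Fubini: `|1 - v| ^ r - 1 + r v` is the integral of `r *
stepProfile r` over `(0, v)`, so swapping the order replaces the law by its tail. -/
lemma inward_jump_aux (hβ1 : 1 < β) (hβ : β < 2) (hr : 0 < r) (hrβ : r < β) (hx : 0 < x)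
    (hK : ∀ y, 0 < y → y ^ β * m.real (Ioi y) ≤ K) :
    IntegrableOn (fun w => |1 - w / x| ^ r - 1 + r * (w / x)) (Ioi 0) m ∧
    ∫ w in Ioi 0, (|1 - w / x| ^ r - 1 + r * (w / x)) ∂m
      = ∫ u in Ioi 0, r * stepProfile r u * m.real (Ioi (u * x)) := by
  set G : ℝ × ℝ → ℝ := fun p => {p : ℝ × ℝ | p.2 * x < p.1}.indicator
    (fun p => r * stepProfile r p.2) p with hG
  have hset : MeasurableSet {p : ℝ × ℝ | p.2 * x < p.1} :=
    measurableSet_lt (by fun_prop) (by fun_prop)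
  have hGm : Measurable G := by
    refine Measurable.indicator ?_ hset
    exact ((measurable_stepProfile r).comp measurable_snd).const_mul r
  have hGu : ∀ u w : ℝ, G (w, u) = (Ioi (u * x)).indicator (fun _ => r * stepProfile r u) w := by
    intro u w
    rfl
  have hbound : ∀ u, 0 < u → m.real (Ioi (u * x)) ≤ K * x ^ (-β) * u ^ (-β) := by
    intro u hu
    have h1 := hK (u * x) (by positivity)
    have h2 : 0 < (u * x) ^ β := by positivity
    rw [mul_assoc, ← Real.mul_rpow hx.le hu.le, mul_comm x u, Real.rpow_neg (by positivity),
      ← div_eq_mul_inv, le_div_iff₀ h2]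
    linarith
  have hmeas_tail : Measurable fun u => m.real (Ioi (u * x)) := by
    refine Antitone.measurable fun u v huv => ?_
    exact measureReal_mono (Ioi_subset_Ioi (by nlinarith))
  have hGint : Integrable G (m.prod (volume.restrict (Ioi 0))) := by
    rw [integrable_prod_iff' hGm.aestronglyMeasurable]
    constructor
    · refine Eventually.of_forall fun u => ?_
      simp_rw [hGu]
      exact (integrable_const _).indicator measurableSet_Ioi
    · have e : ∀ u, ∫ w, ‖G (w, u)‖ ∂m = m.real (Ioi (u * x)) * ‖r * stepProfile r u‖ := by
        intro u
        simp_rw [hGu, norm_indicator_eq_indicator_norm]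
        rw [integral_indicator measurableSet_Ioi]
        simp
      simp_rw [e]
      have hb := ((integrableOn_stepProfile hβ1 hβ hr hrβ).norm).const_mul (K * x ^ (-β) * r)
      refine Integrable.mono' hb (by fun_prop) ?_
      filter_upwards [ae_restrict_mem measurableSet_Ioi] with u hu
      have hu' : (0 : ℝ) < u := hu
      rw [norm_mul, norm_norm, norm_mul, norm_mul, Real.norm_of_nonneg measureReal_nonneg,
        Real.norm_of_nonneg hr.le, Real.norm_of_nonneg (Real.rpow_nonneg hu'.le (-β))]
      calc m.real (Ioi (u * x)) * (r * ‖stepProfile r u‖)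
          ≤ (K * x ^ (-β) * u ^ (-β)) * (r * ‖stepProfile r u‖) := by
            gcongr
            exact hbound u hu'
        _ = _ := by ring
  have hinner : ∀ w, ∫ u in Ioi 0, G (w, u)
      = (Ioi 0).indicator (fun w => |1 - w / x| ^ r - 1 + r * (w / x)) w := by
    intro w
    have e : ∀ u, G (w, u) = (Iio (w / x)).indicator (fun u => r * stepProfile r u) u := by
      intro u
      by_cases h : u * x < w
      · have h' : u < w / x := by rwa [lt_div_iff₀ hx]
        simp [hG, indicator, h, h']
      · have h' : ¬ u < w / x := by rwa [lt_div_iff₀ hx]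
        simp [hG, indicator, h, h']
    simp_rw [e]
    rw [setIntegral_indicator measurableSet_Iio, Ioi_inter_Iio]
    by_cases hw : 0 < w
    · rw [integral_stepProfile hβ1 hβ hr hrβ (by positivity), indicator_of_mem (mem_Ioi.2 hw)]
    · rw [indicator_of_notMem (by simpa using hw), Ioo_eq_empty]
      · simp
      · rw [not_lt]
        exact div_nonpos_of_nonpos_of_nonneg (not_lt.1 hw) hx.le
  constructor
  · have := hGint.integral_prod_left
    simp_rw [hinner] at this
    rwa [integrable_indicator_iff measurableSet_Ioi] at this
  · rw [← integral_indicator measurableSet_Ioi]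
    simp_rw [← hinner]
    rw [integral_integral_swap hGint]
    refine integral_congr_ae (Eventually.of_forall fun u => ?_)
    simp only [hGu]
    rw [integral_indicator measurableSet_Ioi]
    simp [mul_comm]

lemma outward_jump_aux (hr : 0 < r) {s : ℝ} (hrs : r ≤ s) (hs1 : 1 ≤ s) (hs2 : s ≤ 2)
    (hsα : s ≤ α) (hx : 0 < x) (hM0 : 0 ≤ M)
    (hM : ∫⁻ w, ENNReal.ofReal (w⁻ ^ α) ∂m ≤ ENNReal.ofReal M) :
    IntegrableOn (fun w => |1 - w / x| ^ r - 1 + r * (w / x)) (Iic 0) m ∧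
    |∫ w in Iic 0, (|1 - w / x| ^ r - 1 + r * (w / x)) ∂m| ≤ 4 * x ^ (-s) * (1 + M) := by
  have hi := integrable_negPart_rpow hM
  have hb : Integrable (fun w : ℝ => 4 * x ^ (-s) * (1 + w⁻ ^ α)) m :=
    ((integrable_const _).add hi).const_mul _
  have hpt : ∀ w ∈ Iic (0 : ℝ), ‖|1 - w / x| ^ r - 1 + r * (w / x)‖
      ≤ 4 * x ^ (-s) * (1 + w⁻ ^ α) := by
    intro w hw
    have hw' : w ≤ 0 := hw
    have hwn : w⁻ = -w := negPart_eq_neg.2 hw'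
    have hv : 0 ≤ -w / x := div_nonneg (by linarith) hx.le
    have h1 := abs_one_add_rpow_sub_le hr hrs hs1 hs2 hv
    have e : |1 - w / x| ^ r - 1 + r * (w / x) = (1 + -w / x) ^ r - 1 - r * (-w / x) := by
      rw [show 1 - w / x = 1 + -w / x by ring, abs_of_nonneg (by linarith)]; ring
    rw [Real.norm_eq_abs, e]
    refine h1.trans ?_
    rw [Real.div_rpow (by linarith) hx.le, hwn, Real.rpow_neg hx.le, div_eq_mul_inv, mul_assoc,
      mul_comm ((-w) ^ s)]
    gcongr
    rcases le_total (-w) 1 with h | h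
    · have := Real.rpow_le_one (show 0 ≤ -w by linarith) h (show 0 ≤ s by linarith)
      have : 0 ≤ (-w) ^ α := Real.rpow_nonneg (by linarith) _
      linarith
    · have := Real.rpow_le_rpow_of_exponent_le h hsα
      linarith
  have hmeas : Measurable fun w : ℝ => |1 - w / x| ^ r - 1 + r * (w / x) := by fun_prop
  refine ⟨Integrable.mono' hb.integrableOn hmeas.aestronglyMeasurable ?_, ?_⟩
  · filter_upwards [ae_restrict_mem measurableSet_Iic] with w hw using hpt w hw
  · have hMi : ∫ w, w⁻ ^ α ∂m ≤ M := by
      rw [integral_eq_lintegral_of_nonneg_ae (Eventually.of_forall fun w =>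
        Real.rpow_nonneg (negPart_nonneg w) _) hi.aestronglyMeasurable]
      exact ENNReal.toReal_le_of_le_ofReal hM0 hM
    calc |∫ w in Iic 0, (|1 - w / x| ^ r - 1 + r * (w / x)) ∂m|
        ≤ ∫ w in Iic 0, 4 * x ^ (-s) * (1 + w⁻ ^ α) ∂m := by
          rw [← Real.norm_eq_abs]
          refine norm_integral_le_of_norm_le hb.integrableOn ?_
          filter_upwards [ae_restrict_mem measurableSet_Iic] with w hw using hpt w hw
      _ ≤ ∫ w, 4 * x ^ (-s) * (1 + w⁻ ^ α) ∂m := by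
          refine setIntegral_le_integral hb (Eventually.of_forall fun w => ?_)
          have := Real.rpow_nonneg (negPart_nonneg w) α
          show 0 ≤ 4 * x ^ (-s) * (1 + w⁻ ^ α)
          positivity
      _ = 4 * x ^ (-s) * (1 + ∫ w, w⁻ ^ α ∂m) := by
          rw [integral_const_mul, integral_add (integrable_const _) hi]
          simp
      _ ≤ _ := by gcongr

/-- For `r = x = 1` the profile integral is `2 (w - 1)⁺` on positive `w`, which controls `w` up to a
constant. -/
lemma integrable_jump (hβ1 : 1 < β) (hβ : β < 2) (hα : β < α)
    (hK : ∀ y, 0 < y → y ^ β * m.real (Ioi y) ≤ K)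
    (hM : ∫⁻ w, ENNReal.ofReal (w⁻ ^ α) ∂m ≤ ENNReal.ofReal M) :
    Integrable (fun w : ℝ => w) m := by
  have h1 := (inward_jump_aux (x := 1) hβ1 hβ one_pos hβ1 one_pos hK).1
  have h2 := (integrable_indicator_iff measurableSet_Ioi).2 h1
  have h3 := ((integrable_const (μ := m) (2 : ℝ)).add h2).add (integrable_negPart_rpow hM)
  refine Integrable.mono' h3 (by fun_prop) (Eventually.of_forall fun w => ?_)
  simp only [Pi.add_apply, Real.norm_eq_abs]
  rcases le_or_gt w 0 with h | h
  · rw [indicator_of_notMem (by simpa using h), negPart_eq_neg.2 h, abs_of_nonpos h]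
    rcases le_total (-w) 1 with h' | h'
    · have : 0 ≤ (-w) ^ α := Real.rpow_nonneg (by linarith) _
      linarith
    · have := Real.rpow_le_rpow_of_exponent_le h' (show 1 ≤ α by linarith)
      rw [Real.rpow_one] at this
      linarith
  · rw [indicator_of_mem (mem_Ioi.2 h), negPart_eq_zero.2 h.le, abs_of_pos h,
      Real.zero_rpow (by linarith), Real.rpow_one, div_one]
    rcases le_total w 1 with h' | h'
    · rw [abs_of_nonneg (by linarith)]; linarith
    · rw [abs_of_nonpos (by linarith)]; linarith

/-- Here `w` is the inward jump from distance `x`. Centring removes the linear term, the inward part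
matches the tail integral exactly, and the whole error comes from outward jumps. -/
lemma power_moment_aux (hβ1 : 1 < β) (hβ : β < 2) (hα : β < α) (hr : 0 < r) (hrβ : r < β)
    (hx : 0 < x) (hM0 : 0 ≤ M) (hK : ∀ y, 0 < y → y ^ β * m.real (Ioi y) ≤ K)
    (hM : ∫⁻ w, ENNReal.ofReal (w⁻ ^ α) ∂m ≤ ENNReal.ofReal M) :
    Integrable (fun w => |x - w| ^ r) m ∧
    |x ^ (β - r) * (∫ w, |x - w| ^ r ∂m - x ^ r) + r * x ^ (β - 1) * (∫ w, w ∂m)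
      - ∫ u in Ioi 0, r * stepProfile r u * (x ^ β * m.real (Ioi (u * x)))|
      ≤ 4 * x ^ (β - min α 2) * (1 + M) := by
  obtain ⟨i1, e1⟩ := inward_jump_aux hβ1 hβ hr hrβ hx hK
  obtain ⟨i2, e2⟩ := outward_jump_aux (s := min α 2) hr (le_min (by linarith) (by linarith))
    (le_min (by linarith) (by linarith)) (min_le_right _ _) (min_le_left _ _) hx hM0 hM
  have hW := integrable_jump hβ1 hβ hα hK hM
  set h : ℝ → ℝ := fun w => |1 - w / x| ^ r - 1 + r * (w / x) with hh
  have ih : Integrable h m := by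
    rw [← integrableOn_univ, ← Iic_union_Ioi (a := (0 : ℝ))]
    exact i2.union i1
  have eh : ∫ w, h w ∂m = (∫ w in Iic 0, h w ∂m) + ∫ w in Ioi 0, h w ∂m := by
    rw [← compl_Iic, integral_add_compl measurableSet_Iic ih]
  have ef : ∀ w, |x - w| ^ r = x ^ r * h w + x ^ r - r * x ^ (r - 1) * w := by
    intro w
    have : x - w = x * (1 - w / x) := by field_simp
    rw [this, abs_mul, abs_of_pos hx, Real.mul_rpow hx.le (abs_nonneg _), Real.rpow_sub_one hx.ne']
    simp only [hh]
    field_simp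
    ring
  have if1 : Integrable (fun w => x ^ r * h w + x ^ r) m :=
    (ih.const_mul _).add (integrable_const _)
  have if2 : Integrable (fun w => r * x ^ (r - 1) * w) m := hW.const_mul _
  constructor
  · simp_rw [ef]
    exact if1.sub if2
  · simp_rw [ef]
    rw [integral_sub if1 if2, integral_add (ih.const_mul _) (integrable_const _),
      integral_const_mul, integral_const_mul, integral_const]
    have a1 : x ^ (β - r) * x ^ r = x ^ β := by rw [← Real.rpow_add hx]; ring_nf
    have a2 : x ^ (β - r) * x ^ (r - 1) = x ^ (β - 1) := by rw [← Real.rpow_add hx]; ring_nf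
    have a3 : x ^ β * x ^ (-min α 2) = x ^ (β - min α 2) := by
      rw [← Real.rpow_add hx]; ring_nf
    have a4 : ∫ u in Ioi 0, r * stepProfile r u * (x ^ β * m.real (Ioi (u * x)))
        = x ^ β * ∫ w in Ioi 0, h w ∂m := by
      rw [e1, ← integral_const_mul]
      refine integral_congr_ae (Eventually.of_forall fun u => ?_)
      show _ = x ^ β * (r * stepProfile r u * m.real (Ioi (u * x)))
      ring
    have a5 : x ^ (β - r) * (x ^ r * (∫ w, h w ∂m) + m.real univ • x ^ r
        - r * x ^ (r - 1) * (∫ w, w ∂m) - x ^ r) + r * x ^ (β - 1) * (∫ w, w ∂m)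
        = x ^ β * ∫ w, h w ∂m := by
      rw [← a1, ← a2]
      simp
      ring
    rw [a5, a4, eh, mul_add, add_sub_cancel_right, abs_mul, abs_of_pos (by positivity), ← a3]
    calc _ ≤ x ^ β * (4 * x ^ (-min α 2) * (1 + M)) := by gcongr
      _ = _ := by ring

end Jump

/-- Asymptotics of the power moments for a family of jump laws with a common inward tail. -/
lemma tendsto_power_moment {ι : Type*} {l : Filter ι} [l.IsCountablyGenerated] {x : ι → ℝ}
    {m : ι → Measure ℝ} [∀ i, IsProbabilityMeasure (m i)] {α β c r M : ℝ}
    (hβ1 : 1 < β) (hβ : β < 2) (hα : β < α) (hr : 0 < r) (hrβ : r < β)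
    (hx : Tendsto x l atTop)
    (htail : ∀ ε > 0, ∃ Y, ∀ᶠ i in l, ∀ y, Y ≤ y → |y ^ β * (m i).real (Ioi y) - c| ≤ ε)
    (hM0 : 0 ≤ M)
    (hM : ∀ᶠ i in l, ∫⁻ w, ENNReal.ofReal (w⁻ ^ α) ∂(m i) ≤ ENNReal.ofReal M) :
    (∀ᶠ i in l, Integrable (fun w => |x i - w| ^ r) (m i)) ∧
    Tendsto (fun i => x i ^ (β - r) * (∫ w, |x i - w| ^ r ∂(m i) - x i ^ r)
      + r * x i ^ (β - 1) * (∫ w, w ∂(m i))) l (𝓝 (c * (r * tailDrift β r))) := by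
  -- A bound uniform in the family: the tail hypothesis handles large `y`, and probabilities are at
  -- most one for the rest. It supplies the dominating function below.
  obtain ⟨K, hK⟩ : ∃ K, ∀ᶠ i in l, ∀ y, 0 < y → y ^ β * (m i).real (Ioi y) ≤ K := by
    obtain ⟨Y, hY⟩ := htail 1 one_pos
    refine ⟨max (max Y 0 ^ β) (c + 1), ?_⟩
    filter_upwards [hY] with i hi y hy
    rcases le_total Y y with h | h
    · have := (abs_le.1 (hi y h)).2
      exact le_max_of_le_right (by linarith)
    · refine le_max_of_le_left ?_
      calc y ^ β * (m i).real (Ioi y) ≤ y ^ β * 1 := by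
            gcongr
            exact measureReal_le_one
        _ ≤ max Y 0 ^ β := by
            rw [mul_one]
            exact Real.rpow_le_rpow hy.le (h.trans (le_max_left _ _)) (by linarith)
  have hx0 := hx.eventually_gt_atTop 0
  refine ⟨?_, ?_⟩
  · filter_upwards [hK, hM, hx0] with i h1 h2 h3
    exact (power_moment_aux hβ1 hβ hα hr hrβ h3 hM0 h1 h2).1
  have hint := integrableOn_stepProfile hβ1 hβ hr hrβ
  have hI : Tendsto (fun i => ∫ u in Ioi 0, r * stepProfile r u
      * (x i ^ β * (m i).real (Ioi (u * x i)))) l (𝓝 (c * (r * tailDrift β r))) := by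
    have e : c * (r * tailDrift β r) = ∫ u in Ioi 0, r * (stepProfile r u * u ^ (-β)) * c := by
      rw [tailDrift, integral_mul_const, integral_const_mul]; ring
    have e2 : ∀ i u : ℝ, ∀ t : ℝ, 0 < u → 0 < i →
        r * stepProfile r u * (i ^ β * t) = r * (stepProfile r u * u ^ (-β)) * ((u * i) ^ β * t) := by
      intro i u t hu hi
      rw [Real.mul_rpow hu.le hi.le, Real.rpow_neg hu.le]
      field_simp
    rw [e]
    refine tendsto_integral_filter_of_dominated_convergence
      (fun u => ‖r * (stepProfile r u * u ^ (-β))‖ * K) ?_ ?_ ((hint.const_mul r).norm.mul_const K)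
      ?_
    · filter_upwards [hx0] with i hi
      have : Measurable fun u => (m i).real (Ioi (u * x i)) := by
        refine Antitone.measurable fun u v huv => ?_
        exact measureReal_mono (Ioi_subset_Ioi (by nlinarith))
      exact Measurable.aestronglyMeasurable (by fun_prop)
    · filter_upwards [hx0, hK] with i hi hKi
      filter_upwards [ae_restrict_mem measurableSet_Ioi] with u hu
      have hu' : (0 : ℝ) < u := hu
      rw [e2 _ _ _ hu' hi, norm_mul]
      gcongr
      rw [Real.norm_of_nonneg (by positivity)]
      exact hKi _ (by positivity)
    · filter_upwards [ae_restrict_mem measurableSet_Ioi] with u hu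
      have hu' : (0 : ℝ) < u := hu
      have ht : Tendsto (fun i => (u * x i) ^ β * (m i).real (Ioi (u * x i))) l (𝓝 c) := by
        rw [Metric.tendsto_nhds]
        intro ε hε
        obtain ⟨Y, hY⟩ := htail (ε / 2) (by positivity)
        filter_upwards [hY, (hx.const_mul_atTop hu').eventually_ge_atTop Y] with i h1 h2
        rw [Real.dist_eq]
        exact (h1 _ h2).trans_lt (by linarith)
      refine (ht.const_mul (r * (stepProfile r u * u ^ (-β)))).congr' ?_
      filter_upwards [hx0] with i hi
      exact (e2 _ _ _ hu' hi).symm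
  have hE : Tendsto (fun i => 4 * x i ^ (β - min α 2) * (1 + M)) l (𝓝 0) := by
    have h1 : 0 < min α 2 - β := sub_pos.2 (lt_min hα hβ)
    have h2 := ((tendsto_rpow_neg_atTop h1).comp hx).const_mul 4 |>.mul_const (1 + M)
    simpa [Function.comp_def] using h2
  have hd : Tendsto (fun i => x i ^ (β - r) * (∫ w, |x i - w| ^ r ∂(m i) - x i ^ r)
      + r * x i ^ (β - 1) * (∫ w, w ∂(m i)) - ∫ u in Ioi 0, r * stepProfile r u
      * (x i ^ β * (m i).real (Ioi (u * x i)))) l (𝓝 0) := by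
    refine squeeze_zero_norm' ?_ hE
    filter_upwards [hK, hM, hx0] with i h1 h2 h3
    exact (power_moment_aux hβ1 hβ hα hr hrβ h3 hM0 h1 h2).2
  simpa using hd.add hI

/-! ### Lyapunov increments of the chain far from the origin -/

/-- Neighbourhoods of infinity in the state space. -/
def awayFilter (X : Set ℝ) : Filter X := comap (fun x : X => |(x : ℝ)|) atTop

lemma awayFilter_eq (X : Set ℝ) : awayFilter X
    = comap (fun x : X => (x : ℝ)) atBot ⊔ comap (fun x : X => (x : ℝ)) atTop := by
  rw [awayFilter, ← comap_sup, ← comap_abs_atTop, comap_comap]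
  rfl

lemma eventually_awayFilter {p : X → Prop} (h : ∀ᶠ x in awayFilter X, p x) :
    ∀ᶠ a : ℝ in atTop, ∀ x : X, a < |(x : ℝ)| → p x := by
  rw [awayFilter, eventually_comap, eventually_atTop] at h
  obtain ⟨A, hA⟩ := h
  filter_upwards [eventually_ge_atTop A] with a ha x hx
  exact hA _ (ha.trans hx.le) x rfl

lemma tendsto_abs_awayFilter : Tendsto (fun x : X => |(x : ℝ)|) (awayFilter X) atTop :=
  tendsto_comap

/-- The drift in the direction away from the origin. -/
noncomputable def outwardDrift (P : Kernel X X) (x : X) : ℝ :=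
  if 0 ≤ (x : ℝ) then drift P x else -drift P x

lemma DriftAsymptotics.tendsto_outwardDrift {P : Kernel X X} {γ b : ℝ}
    (hD : DriftAsymptotics P γ b) :
    Tendsto (fun x : X => |(x : ℝ)| ^ γ * outwardDrift P x) (awayFilter X) (𝓝 b) := by
  rw [awayFilter_eq, tendsto_sup]
  constructor
  · refine hD.left.congr' ?_
    filter_upwards [tendsto_comap.eventually_lt_atBot 0] with x hx
    rw [outwardDrift, if_neg (not_le.2 hx)]
    ring
  · refine hD.right.congr' ?_
    filter_upwards [tendsto_comap.eventually_ge_atTop 0] with x hx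
    rw [outwardDrift, if_pos hx, abs_of_nonneg hx]

lemma abs_sub_le_of_tendsto_iSup {s : Set X} {F : X → ℝ → ℝ}
    (h : Tendsto (fun y : ℝ => ⨆ (x : X) (_ : x ∈ s), ENNReal.ofReal |F x y|) atTop (𝓝 0))
    {ε : ℝ} (hε : 0 < ε) : ∃ Y, ∀ x ∈ s, ∀ y, Y ≤ y → |F x y| ≤ ε := by
  have h1 := h.eventually_lt_const (show (0 : ℝ≥0∞) < ENNReal.ofReal ε by simpa)
  obtain ⟨Y, hY⟩ := eventually_atTop.1 h1
  refine ⟨Y, fun x hx y hy => ?_⟩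
  rw [← ENNReal.ofReal_le_ofReal_iff hε.le]
  exact (le_iSup₂ (f := fun (x : X) (_ : x ∈ s) => ENNReal.ofReal |F x y|) x hx).trans (hY y hy).le

lemma InwardTails.exists_tailNeg {P : Kernel X X} {α β c x₀ : ℝ} (hT : InwardTails P α β c x₀)
    {ε : ℝ} (hε : 0 < ε) : ∃ Y, ∀ x : X, x₀ ≤ (x : ℝ) → ∀ y, Y ≤ y →
      |y ^ β * tailNeg P x y - c| ≤ ε :=
  abs_sub_le_of_tendsto_iSup (s := {x : X | x₀ ≤ (x : ℝ)})
    (F := fun x y => y ^ β * tailNeg P x y - c) hT.tail_right hε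

lemma InwardTails.exists_tailPos {P : Kernel X X} {α β c x₀ : ℝ} (hT : InwardTails P α β c x₀)
    {ε : ℝ} (hε : 0 < ε) : ∃ Y, ∀ x : X, (x : ℝ) ≤ -x₀ → ∀ y, Y ≤ y →
      |y ^ β * tailPos P x y - c| ≤ ε :=
  abs_sub_le_of_tendsto_iSup (s := {x : X | (x : ℝ) ≤ -x₀})
    (F := fun x y => y ^ β * tailPos P x y - c) hT.tail_left hε

lemma lt_negPart_iff {y t : ℝ} (hy : 0 ≤ y) : y < t⁻ ↔ y < -t := by
  rw [negPart_def, lt_sup_iff]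
  exact ⟨fun h => h.resolve_right (not_lt.2 hy), Or.inl⟩

lemma lt_posPart_iff' {y t : ℝ} (hy : 0 ≤ y) : y < t⁺ ↔ y < t := by
  rw [posPart_def, lt_sup_iff]
  exact ⟨fun h => h.resolve_right (not_lt.2 hy), Or.inl⟩

/-- On the right the inward jump is `x - ξ₁`, so `θ₋` is its positive part and its mean is minus the
drift. -/
lemma tendsto_power_moment_right {P : Kernel X X} [IsMarkovKernel P] {α β c x₀ r : ℝ}
    (hT : InwardTails P α β c x₀) (hr : 0 < r) (hrβ : r < β) :
    (∀ᶠ x in comap (fun x : X => (x : ℝ)) atTop, Integrable (fun z : X => |(z : ℝ)| ^ r) (P x)) ∧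
    Tendsto (fun x : X => |(x : ℝ)| ^ (β - r) * (∫ z, |(z : ℝ)| ^ r ∂(P x) - |(x : ℝ)| ^ r)
      - r * |(x : ℝ)| ^ (β - 1) * outwardDrift P x) (comap (fun x : X => (x : ℝ)) atTop)
      (𝓝 (c * (r * tailDrift β r))) := by
  have hm : ∀ x : X, Measurable fun z : X => (x : ℝ) - z := fun x => by fun_prop
  have hprob : ∀ x : X, IsProbabilityMeasure ((P x).map fun z : X => (x : ℝ) - z) :=
    fun x => Measure.isProbabilityMeasure_map (hm x).aemeasurable
  have hpow : ∀ x : X, Measurable fun w : ℝ => |(x : ℝ) - w| ^ r := fun x => by fun_prop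
  have hxt : Tendsto (fun x : X => (x : ℝ)) (comap (fun x : X => (x : ℝ)) atTop) atTop :=
    tendsto_comap
  have key := tendsto_power_moment (l := comap (fun x : X => (x : ℝ)) atTop)
    (x := fun x : X => (x : ℝ)) (m := fun x => (P x).map fun z : X => (x : ℝ) - z)
    (α := α) (β := β) (c := c) (r := r)
    (M := (⨆ (x : X) (_ : x₀ ≤ (x : ℝ)), momentPos P α x).toReal)
    hT.one_lt_beta hT.beta_lt_two hT.beta_lt_alpha hr hrβ hxt ?_ ENNReal.toReal_nonneg ?_
  · have e1 : ∀ x : X, ∫ w, |(x : ℝ) - w| ^ r ∂((P x).map fun z : X => (x : ℝ) - z)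
        = ∫ z : X, |(z : ℝ)| ^ r ∂(P x) := by
      intro x
      rw [integral_map (hm x).aemeasurable (hpow x).aestronglyMeasurable]
      simp
    have e2 : ∀ x : X, ∫ w, w ∂((P x).map fun z : X => (x : ℝ) - z) = -drift P x := by
      intro x
      rw [integral_map (hm x).aemeasurable (by fun_prop), drift, ← integral_neg]
      simp
    simp_rw [e1, e2] at key
    refine ⟨?_, ?_⟩
    · filter_upwards [key.1] with x hx
      rw [integrable_map_measure (hpow x).aestronglyMeasurable (hm x).aemeasurable] at hx
      simpa [Function.comp_def] using hx
    · refine key.2.congr' ?_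
      filter_upwards [hxt.eventually_ge_atTop 0] with x hx
      rw [outwardDrift, if_pos hx, abs_of_nonneg hx]
      ring
  · intro ε hε
    obtain ⟨Y, hY⟩ := hT.exists_tailNeg hε
    refine ⟨max Y 0, ?_⟩
    filter_upwards [hxt.eventually_ge_atTop x₀] with x hx y hy
    have hy0 := (le_max_right _ _).trans hy
    have e : ((P x).map fun z : X => (x : ℝ) - z).real (Ioi y) = tailNeg P x y := by
      rw [map_measureReal_apply (hm x) measurableSet_Ioi, tailNeg]
      congr 1
      ext z
      simp [lt_negPart_iff hy0]
    rw [e]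
    exact hY x hx y ((le_max_left _ _).trans hy)
  · filter_upwards [hxt.eventually_ge_atTop x₀] with x hx
    rw [ENNReal.ofReal_toReal hT.moment_right.ne, lintegral_map
      (Measurable.ennreal_ofReal (Measurable.pow_const (by fun_prop) _)) (hm x)]
    refine le_trans (le_of_eq ?_) (le_iSup₂ (f := fun (x : X) (_ : x₀ ≤ (x : ℝ)) =>
      momentPos P α x) x hx)
    rw [momentPos]
    refine lintegral_congr fun z => ?_
    rw [← neg_sub, negPart_neg]

/-- Mirror image: the distance is `-x` and the inward jump is `ξ₁ - x`. -/
lemma tendsto_power_moment_left {P : Kernel X X} [IsMarkovKernel P] {α β c x₀ r : ℝ}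
    (hT : InwardTails P α β c x₀) (hr : 0 < r) (hrβ : r < β) :
    (∀ᶠ x in comap (fun x : X => (x : ℝ)) atBot, Integrable (fun z : X => |(z : ℝ)| ^ r) (P x)) ∧
    Tendsto (fun x : X => |(x : ℝ)| ^ (β - r) * (∫ z, |(z : ℝ)| ^ r ∂(P x) - |(x : ℝ)| ^ r)
      - r * |(x : ℝ)| ^ (β - 1) * outwardDrift P x) (comap (fun x : X => (x : ℝ)) atBot)
      (𝓝 (c * (r * tailDrift β r))) := by
  have hm : ∀ x : X, Measurable fun z : X => (z : ℝ) - x := fun x => by fun_prop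
  have hprob : ∀ x : X, IsProbabilityMeasure ((P x).map fun z : X => (z : ℝ) - x) :=
    fun x => Measure.isProbabilityMeasure_map (hm x).aemeasurable
  have hpow : ∀ x : X, Measurable fun w : ℝ => |-(x : ℝ) - w| ^ r := fun x => by fun_prop
  have hxb : Tendsto (fun x : X => (x : ℝ)) (comap (fun x : X => (x : ℝ)) atBot) atBot :=
    tendsto_comap
  have hxt := tendsto_neg_atBot_atTop.comp hxb
  have key := tendsto_power_moment (l := comap (fun x : X => (x : ℝ)) atBot)
    (x := fun x : X => -(x : ℝ)) (m := fun x => (P x).map fun z : X => (z : ℝ) - x)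
    (α := α) (β := β) (c := c) (r := r)
    (M := (⨆ (x : X) (_ : (x : ℝ) ≤ -x₀), momentNeg P α x).toReal)
    hT.one_lt_beta hT.beta_lt_two hT.beta_lt_alpha hr hrβ hxt ?_ ENNReal.toReal_nonneg ?_
  · have e0 : ∀ x z : X, |-(x : ℝ) - ((z : ℝ) - x)| = |(z : ℝ)| := fun x z => by
      rw [← abs_neg]; ring_nf
    have e1 : ∀ x : X, ∫ w, |-(x : ℝ) - w| ^ r ∂((P x).map fun z : X => (z : ℝ) - x)
        = ∫ z : X, |(z : ℝ)| ^ r ∂(P x) := by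
      intro x
      rw [integral_map (hm x).aemeasurable (hpow x).aestronglyMeasurable]
      simp only [e0]
    have e2 : ∀ x : X, ∫ w, w ∂((P x).map fun z : X => (z : ℝ) - x) = drift P x := by
      intro x
      rw [integral_map (hm x).aemeasurable (by fun_prop), drift]
    simp_rw [e1, e2] at key
    refine ⟨?_, ?_⟩
    · filter_upwards [key.1] with x hx
      rw [integrable_map_measure (hpow x).aestronglyMeasurable (hm x).aemeasurable] at hx
      simpa [Function.comp_def, e0] using hx
    · refine key.2.congr' ?_
      filter_upwards [hxb.eventually_lt_atBot 0] with x hx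
      rw [outwardDrift, if_neg (not_le.2 hx), abs_of_neg hx]
      ring
  · intro ε hε
    obtain ⟨Y, hY⟩ := hT.exists_tailPos hε
    refine ⟨max Y 0, ?_⟩
    filter_upwards [hxb.eventually_le_atBot (-x₀)] with x hx y hy
    have hy0 := (le_max_right _ _).trans hy
    have e : ((P x).map fun z : X => (z : ℝ) - x).real (Ioi y) = tailPos P x y := by
      rw [map_measureReal_apply (hm x) measurableSet_Ioi, tailPos]
      congr 1
      ext z
      simp [lt_posPart_iff' hy0]
    rw [e]
    exact hY x hx y ((le_max_left _ _).trans hy)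
  · filter_upwards [hxb.eventually_le_atBot (-x₀)] with x hx
    rw [ENNReal.ofReal_toReal hT.moment_left.ne, lintegral_map
      (Measurable.ennreal_ofReal (Measurable.pow_const (by fun_prop) _)) (hm x)]
    exact le_iSup₂ (f := fun (x : X) (_ : (x : ℝ) ≤ -x₀) => momentNeg P α x) x hx

/-- The increment of the Lyapunov function `|x| ^ r`. -/
noncomputable def powerDrift (P : Kernel X X) (r : ℝ) (x : X) : ℝ :=
  ∫ z, |(z : ℝ)| ^ r ∂(P x) - |(x : ℝ)| ^ r

section Asymptotics

variable {P : Kernel X X} {α β c x₀ γ b r : ℝ}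

lemma killed_rpow_le {a : ℝ} {x : X} (hi : Integrable (fun z : X => |(z : ℝ)| ^ r) (P x)) :
    killed P a (fun z => ENNReal.ofReal (|(z : ℝ)| ^ r)) x
      ≤ ENNReal.ofReal (∫ z, |(z : ℝ)| ^ r ∂(P x)) := by
  rw [ofReal_integral_eq_lintegral_ofReal hi (Eventually.of_forall fun z => by positivity)]
  exact lintegral_mono fun z => indicator_le_self' (by simp) z

lemma killed_rpow_add_le {a ε t : ℝ} {x : X} (hε : 0 ≤ ε) (ht : 0 ≤ t)
    (hi : Integrable (fun z : X => |(z : ℝ)| ^ r) (P x)) (h : powerDrift P r x ≤ -(ε * t)) :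
    killed P a (fun z => ENNReal.ofReal (|(z : ℝ)| ^ r)) x + ENNReal.ofReal ε * ENNReal.ofReal t
      ≤ ENNReal.ofReal (|(x : ℝ)| ^ r) := by
  refine (add_le_add_left (killed_rpow_le hi) _).trans ?_
  rw [← ENNReal.ofReal_mul hε, ← ENNReal.ofReal_add (integral_nonneg fun z => by positivity)
    (by positivity)]
  refine ENNReal.ofReal_le_ofReal ?_
  rw [powerDrift] at h
  linarith

lemma killed_rpow_le_add {a C : ℝ} {x : X} (hC : 0 ≤ C)
    (hi : Integrable (fun z : X => |(z : ℝ)| ^ r) (P x)) (h : powerDrift P r x ≤ C) :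
    killed P a (fun z => ENNReal.ofReal (|(z : ℝ)| ^ r)) x
      ≤ ENNReal.ofReal (|(x : ℝ)| ^ r) + ENNReal.ofReal C := by
  refine (killed_rpow_le hi).trans ?_
  rw [← ENNReal.ofReal_add (by positivity) hC]
  refine ENNReal.ofReal_le_ofReal ?_
  rw [powerDrift] at h
  linarith

variable [IsMarkovKernel P]

lemma InwardTails.eventually_integrable (hT : InwardTails P α β c x₀) (hr : 0 < r)
    (hrβ : r < β) :
    ∀ᶠ x in awayFilter X, Integrable (fun z : X => |(z : ℝ)| ^ r) (P x) := by
  rw [awayFilter_eq, eventually_sup]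
  exact ⟨(tendsto_power_moment_left hT hr hrβ).1, (tendsto_power_moment_right hT hr hrβ).1⟩

lemma InwardTails.tendsto_powerDrift_sub (hT : InwardTails P α β c x₀) (hr : 0 < r)
    (hrβ : r < β) :
    Tendsto (fun x : X => |(x : ℝ)| ^ (β - r) * powerDrift P r x
      - r * |(x : ℝ)| ^ (β - 1) * outwardDrift P x) (awayFilter X)
      (𝓝 (c * (r * tailDrift β r))) := by
  rw [awayFilter_eq, tendsto_sup]
  exact ⟨(tendsto_power_moment_left hT hr hrβ).2, (tendsto_power_moment_right hT hr hrβ).2⟩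

lemma tendsto_powerDrift_critical (hT : InwardTails P α β c x₀)
    (hD : DriftAsymptotics P (β - 1) b) (hr : 0 < r) (hrβ : r < β) :
    Tendsto (fun x : X => |(x : ℝ)| ^ (β - r) * powerDrift P r x) (awayFilter X)
      (𝓝 (r * (b + c * tailDrift β r))) := by
  have h := (hT.tendsto_powerDrift_sub hr hrβ).add (hD.tendsto_outwardDrift.const_mul r)
  convert h using 2 <;> ring

/-- At the scale of the drift, the tail contribution carries the vanishing factor `|x| ^ (-(β - 1 -
γ))`. -/
lemma tendsto_powerDrift_subcritical (hT : InwardTails P α β c x₀)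
    (hD : DriftAsymptotics P γ b) (hγ : γ < β - 1) (hr : 0 < r) (hrβ : r < β) :
    Tendsto (fun x : X => |(x : ℝ)| ^ (1 + γ - r) * powerDrift P r x) (awayFilter X)
      (𝓝 (r * b)) := by
  have h0 : Tendsto (fun x : X => |(x : ℝ)| ^ (-(β - 1 - γ))) (awayFilter X) (𝓝 0) :=
    (tendsto_rpow_neg_atTop (by linarith)).comp tendsto_abs_awayFilter
  have h := (h0.mul (hT.tendsto_powerDrift_sub hr hrβ)).add (hD.tendsto_outwardDrift.const_mul r)
  rw [zero_mul, zero_add] at h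
  refine h.congr' ?_
  filter_upwards [tendsto_abs_awayFilter.eventually_gt_atTop 0] with x hx
  have e1 : |(x : ℝ)| ^ (1 + γ - r) = |(x : ℝ)| ^ (-(β - 1 - γ)) * |(x : ℝ)| ^ (β - r) := by
    rw [← Real.rpow_add hx]; ring_nf
  have e2 : |(x : ℝ)| ^ γ = |(x : ℝ)| ^ (-(β - 1 - γ)) * |(x : ℝ)| ^ (β - 1) := by
    rw [← Real.rpow_add hx]; ring_nf
  rw [e1, e2]
  ring

/-- After subtracting `a ^ r` the function is nonpositive inside `[-a, a]`, so killing merely takes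
its positive part and cannot spoil a lower bound. -/
lemma rpow_sub_le_killed_add {a C : ℝ} {x : X} (hr : 0 < r) (hC : 0 ≤ C)
    (hi : Integrable (fun z : X => |(z : ℝ)| ^ r) (P x)) (h : -C ≤ powerDrift P r x) :
    ENNReal.ofReal (|(x : ℝ)| ^ r - a ^ r)
      ≤ killed P a (fun z => ENNReal.ofReal (|(z : ℝ)| ^ r - a ^ r)) x + ENNReal.ofReal C := by
  have e : killed P a (fun z => ENNReal.ofReal (|(z : ℝ)| ^ r - a ^ r)) x
      = ∫⁻ z, ENNReal.ofReal (max (|(z : ℝ)| ^ r - a ^ r) 0) ∂(P x) := by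
    refine lintegral_congr fun z => ?_
    rw [ENNReal.ofReal_max, ENNReal.ofReal_zero, max_eq_left zero_le]
    by_cases hz : a < |(z : ℝ)|
    · rw [indicator_of_mem (show z ∈ {z : X | a < |(z : ℝ)|} from hz)]
    · rw [indicator_of_notMem (show z ∉ {z : X | a < |(z : ℝ)|} from hz), eq_comm,
        ENNReal.ofReal_eq_zero, sub_nonpos]
      exact Real.rpow_le_rpow (abs_nonneg _) (not_lt.1 hz) hr.le
  have hi2 : Integrable (fun z : X => |(z : ℝ)| ^ r - a ^ r) (P x) := hi.sub (integrable_const _)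
  have hi3 : Integrable (fun z : X => max (|(z : ℝ)| ^ r - a ^ r) 0) (P x) := hi2.pos_part
  have h0 : ∀ z : X, 0 ≤ max (|(z : ℝ)| ^ r - a ^ r) 0 := fun z => le_max_right _ _
  rw [e, ← ofReal_integral_eq_lintegral_ofReal hi3 (Eventually.of_forall h0),
    ← ENNReal.ofReal_add (integral_nonneg h0) hC]
  refine ENNReal.ofReal_le_ofReal ?_
  have h1 : ∫ z : X, (|(z : ℝ)| ^ r - a ^ r) ∂(P x)
      ≤ ∫ z : X, max (|(z : ℝ)| ^ r - a ^ r) 0 ∂(P x) :=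
    integral_mono hi2 hi3 fun z => le_max_left _ _
  rw [integral_sub hi (integrable_const _)] at h1
  simp only [integral_const, probReal_univ, one_smul] at h1
  rw [powerDrift] at h
  linarith

end Asymptotics

/-! ### Comparison of moments and of drift exponents -/

lemma passageMoment_le_one_add (P : Kernel X X) [IsMarkovKernel P] {p q : ℝ} (hp : 0 < p)
    (hpq : p ≤ q) (a : ℝ) (x : X) : passageMoment P p a x ≤ 1 + passageMoment P q a x := by
  have : IsProbabilityMeasure (pathLaw P x) := by
    unfold pathLaw; infer_instance
  calc passageMoment P p a x
      ≤ ∫⁻ ξ, 1 + ((passageTime a ξ : ℕ∞) : ℝ≥0∞) ^ q ∂(pathLaw P x) := by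
        refine lintegral_mono fun ξ => ?_
        dsimp only
        rcases le_total ((passageTime a ξ : ℕ∞) : ℝ≥0∞) 1 with h | h
        · exact (ENNReal.rpow_le_one h hp.le).trans le_self_add
        · exact (ENNReal.rpow_le_rpow_of_exponent_le h hpq).trans le_add_self
    _ = _ := by
        rw [lintegral_add_left measurable_const]
        simp [passageMoment]

lemma passageMoment_lt_top_mono (P : Kernel X X) [IsMarkovKernel P] {p q : ℝ} (hp : 0 < p)
    (hpq : p ≤ q) {a : ℝ} {x : X} (h : passageMoment P q a x < ⊤) : passageMoment P p a x < ⊤ :=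
  (passageMoment_le_one_add P hp hpq a x).trans_lt (ENNReal.add_lt_top.2 ⟨by simp, h⟩)

lemma passageMoment_eq_top_mono (P : Kernel X X) [IsMarkovKernel P] {p q : ℝ} (hp : 0 < p)
    (hpq : p ≤ q) {a : ℝ} {x : X} (h : passageMoment P p a x = ⊤) : passageMoment P q a x = ⊤ := by
  by_contra hne
  exact (passageMoment_lt_top_mono P hp hpq (lt_top_iff_ne_top.2 hne)).ne h

/-- A drift of smaller order than the jump scale is negligible at the jump scale. -/
lemma DriftAsymptotics.of_lt {P : Kernel X X} {γ b : ℝ}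
    (hD : DriftAsymptotics P γ b) {γ' : ℝ}
    (hγ' : 0 ≤ γ') (h : γ' < γ) : DriftAsymptotics P γ' 0 := by
  have h0 := tendsto_rpow_neg_atTop (y := γ - γ') (by linarith)
  refine ⟨hγ', ?_, ?_⟩
  · have hx : Tendsto (fun x : X => (x : ℝ)) (comap (fun x : X => (x : ℝ)) atTop) atTop :=
      tendsto_comap
    have := (h0.comp hx).mul hD.right
    rw [zero_mul] at this
    refine this.congr' ?_
    filter_upwards [hx.eventually_gt_atTop 0] with x hx0
    rw [Function.comp_apply, ← mul_assoc, ← Real.rpow_add hx0]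
    ring_nf
  · have hx : Tendsto (fun x : X => (x : ℝ)) (comap (fun x : X => (x : ℝ)) atBot) atBot :=
      tendsto_comap
    have := (h0.comp (tendsto_abs_atBot_atTop.comp hx)).mul hD.left
    rw [zero_mul] at this
    refine this.congr' ?_
    filter_upwards [hx.eventually_lt_atBot 0] with x hx0
    have e : |(x : ℝ)| ^ γ' = |(x : ℝ)| ^ (-(γ - γ')) * |(x : ℝ)| ^ γ := by
      rw [← Real.rpow_add (abs_pos.2 hx0.ne)]; ring_nf
    rw [Function.comp_apply, Function.comp_apply, e]
    ring

/-! ### Moment bounds when tails and drift balance, and when drift dominates -/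

section Main

variable {P : Kernel X X} [IsMarkovKernel P] {α β c x₀ γ b ν q : ℝ}

/-- The natural clock is `w = |x| ^ β`: with `r = β p` below the root, the increment of `w ^ p` is
at most a negative multiple of `|x| ^ (r-β) = w ^ (p-1)`. -/
lemma finite_moment_critical (hT : InwardTails P α β c x₀) (hD : DriftAsymptotics P (β - 1) b)
    (hν : ν ∈ Ioo 0 β) (hb : b + c * tailDrift β ν = 0) (hq : 0 < q) (hqν : q < ν / β) :
    ∀ᶠ a : ℝ in atTop, ∀ x : X, a < |(x : ℝ)| → passageMoment P q a x < ⊤ := by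
  have hβ0 : 0 < β := by linarith [hT.one_lt_beta]
  obtain ⟨p, hqp, hpν⟩ := exists_between hqν
  have hp : 0 < p := hq.trans hqp
  have hp1 : p < 1 := hpν.trans ((div_lt_one hβ0).2 hν.2)
  set r := β * p with hr
  have hr0 : 0 < r := by positivity
  have hrν : r < ν := by rw [lt_div_iff₀ hβ0] at hpν; linarith
  have hneg : r * (b + c * tailDrift β r) < 0 := by
    have h1 := tailDrift_strictMono hT.one_lt_beta hT.beta_lt_two hr0 hrν hν.2
    have h2 := mul_lt_mul_of_pos_left h1 hT.c_pos
    exact mul_neg_of_pos_of_neg hr0 (by linarith)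
  set ℓ := -(r * (b + c * tailDrift β r)) with hℓ
  have hlim := tendsto_powerDrift_critical hT hD hr0 (hrν.trans hν.2)
  have hev := eventually_awayFilter ((hlim.eventually_lt_const
    (show r * (b + c * tailDrift β r) < -(ℓ / 2) by linarith)).and
    (hT.eventually_integrable hr0 (hrν.trans hν.2)))
  filter_upwards [hev, eventually_ge_atTop 0] with a ha ha0 x hx
  have hw : ∀ z : X, (|(z : ℝ)| ^ β) ^ p = |(z : ℝ)| ^ r := fun z => by
    rw [← Real.rpow_mul (abs_nonneg _)]
  refine passageMoment_lt_top_of_lt_one P (ε := ℓ / 2) (p := p) (w := fun z => |(z : ℝ)| ^ β)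
    (by linarith) hq hqp hp1 (by fun_prop)
    (fun z hz => Real.rpow_pos_of_pos (ha0.trans_lt hz) _) (fun z hz => ?_) hx
  have hz0 := ha0.trans_lt hz
  simp_rw [hw]
  refine killed_rpow_add_le (by linarith) (by positivity) (ha z hz).2 ?_
  have h1 := (ha z hz).1
  have e : (|(z : ℝ)| ^ β) ^ (p - 1) * |(z : ℝ)| ^ (β - r) = 1 := by
    rw [← Real.rpow_mul (abs_nonneg _), ← Real.rpow_add hz0, hr]
    ring_nf
    simp
  have h2 := mul_le_mul_of_nonneg_left h1.le
    (show 0 ≤ (|(z : ℝ)| ^ β) ^ (p - 1) by positivity)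
  rw [← mul_assoc, e, one_mul] at h2
  linarith

lemma infinite_moment_critical (hT : InwardTails P α β c x₀) (hD : DriftAsymptotics P (β - 1) b)
    (hν : ν ∈ Ioo 0 β) (hb : b + c * tailDrift β ν = 0) (hqν : ν / β < q) :
    ∀ᶠ a : ℝ in atTop, ∀ x : X, a < |(x : ℝ)| → passageMoment P q a x = ⊤ := by
  have hβ0 : 0 < β := by linarith [hT.one_lt_beta]
  -- Choose `ν/β < p < min q 1`, then `ν < s < β p`, then `s/p < r < β`. Thus `|x| ^ s` has positive
  -- increments, `|x| ^ r` has bounded ones, and `s / r < p`.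
  obtain ⟨p, hνp, hp⟩ := exists_between (lt_min hqν ((div_lt_one hβ0).2 hν.2))
  have hp0 : 0 < p := (div_pos hν.1 hβ0).trans hνp
  have hp1 : p < 1 := hp.trans_le (min_le_right _ _)
  obtain ⟨s, hνs, hsp⟩ := exists_between ((div_lt_iff₀ hβ0).1 hνp)
  have hs0 : 0 < s := hν.1.trans hνs
  obtain ⟨r, hsr, hrβ⟩ := exists_between ((div_lt_iff₀ hp0).2 (by linarith : s < β * p))
  have hss : s < s / p := by rw [lt_div_iff₀ hp0]; nlinarith
  have hr0 : 0 < r := by linarith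
  have hsβ : s < β := by linarith
  have hpos : 0 < s * (b + c * tailDrift β s) := by
    have h1 := tailDrift_strictMono hT.one_lt_beta hT.beta_lt_two hν.1 hνs hsβ
    have h2 := mul_lt_mul_of_pos_left h1 hT.c_pos
    exact mul_pos hs0 (by linarith)
  have hev1 := eventually_awayFilter (((tendsto_powerDrift_critical hT hD hs0 hsβ).eventually_const_lt
    hpos).and (hT.eventually_integrable hs0 hsβ))
  set C := |r * (b + c * tailDrift β r)| + 1 with hC
  have hev2 := eventually_awayFilter (((tendsto_powerDrift_critical hT hD hr0 hrβ).eventually_lt_const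
    (show r * (b + c * tailDrift β r) < C by
      have := le_abs_self (r * (b + c * tailDrift β r)); linarith)).and
    (hT.eventually_integrable hr0 hrβ))
  filter_upwards [hev1, hev2, eventually_ge_atTop 1] with a ha1 ha2 ha x hx
  refine passageMoment_eq_top_mono P hp0 (hp.le.trans (min_le_left _ _)) ?_
  refine passageMoment_eq_top_of_submartingale P (ν := s) (r := r) (C := ENNReal.ofReal C)
    ENNReal.ofReal_ne_top (by linarith) hs0 (by linarith) hp0 hp1
    ((div_lt_iff₀ hr0).2 (by rw [div_lt_iff₀ hp0] at hsr; linarith))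
    (fun z hz => ?_) (fun z hz => ?_) hx
  · have hz0 : 0 < |(z : ℝ)| := by linarith
    have h1 := pos_of_mul_pos_right (ha1 z hz).1 (by positivity)
    simpa using rpow_sub_le_killed_add (a := a) (C := 0) hs0 le_rfl (ha1 z hz).2
      (by simpa using h1.le)
  · have hz1 : 1 ≤ |(z : ℝ)| := by linarith
    refine killed_rpow_le_add (by positivity) (ha2 z hz).2 ?_
    by_contra hlt
    push Not at hlt
    have h1 := (ha2 z hz).1
    have h2 : 1 ≤ |(z : ℝ)| ^ (β - r) := Real.one_le_rpow hz1 (by linarith)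
    have hC0 : 0 < C := by positivity
    nlinarith

/-- The clock is `w = |x| ^ (γ+1)`, whose increment tends to `(γ+1) b < 0`. Since `β/(γ+1) > 1`, the
order can be raised to `max q 1`, so the criterion for orders at least one applies. -/
lemma finite_moment_subcritical (hT : InwardTails P α β c x₀) (hD : DriftAsymptotics P γ b)
    (hγ : γ < β - 1) (hb : b < 0) (hq : 0 < q) (hqγ : q < β / (γ + 1)) :
    ∀ᶠ a : ℝ in atTop, ∀ x : X, a < |(x : ℝ)| → passageMoment P q a x < ⊤ := by
  have hγ0 := hD.gamma_nonneg
  have hγ1 : 0 < γ + 1 := by linarith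
  have hone : 1 < β / (γ + 1) := by rw [one_lt_div hγ1]; linarith
  obtain ⟨p, hqp, hp⟩ := exists_between (max_lt hqγ hone)
  have hp1 : 1 < p := (le_max_right _ _).trans_lt hqp
  have hp2 : p < 2 := by
    rw [lt_div_iff₀ hγ1] at hp
    nlinarith [hT.beta_lt_two]
  set r := (γ + 1) * p with hr
  have hr0 : 0 < r := by positivity
  have hrβ : r < β := by rw [lt_div_iff₀ hγ1] at hp; linarith
  have hev1 := eventually_awayFilter (((tendsto_powerDrift_subcritical hT hD hγ hr0
    hrβ).eventually_lt_const (show r * b < r * b / 2 by nlinarith)).and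
    (hT.eventually_integrable hr0 hrβ))
  have hev2 := eventually_awayFilter (((tendsto_powerDrift_subcritical hT hD hγ hγ1
    (by linarith)).eventually_lt_const (show (γ + 1) * b < (γ + 1) * b / 2 by nlinarith)).and
    (hT.eventually_integrable hγ1 (by linarith)))
  set ε := -((γ + 1) * b / 2) with hε
  have hε0 : 0 < ε := by rw [hε]; nlinarith
  -- The same `ε` serves both Lyapunov inequalities because `p > 1` and `b < 0`.
  have hεr : r * b / 2 ≤ -ε := by rw [hε, hr]; nlinarith
  filter_upwards [hev1, hev2, eventually_ge_atTop 0] with a ha1 ha2 ha0 x hx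
  have hw : ∀ z : X, (|(z : ℝ)| ^ (γ + 1)) ^ p = |(z : ℝ)| ^ r := fun z => by
    rw [← Real.rpow_mul (abs_nonneg _)]
  refine passageMoment_lt_top_mono P hq (le_max_left q 1) ?_
  refine passageMoment_lt_top_of_one_le P (ε := ε) (p := p) (w := fun z => |(z : ℝ)| ^ (γ + 1))
    hε0 (le_max_right _ _) hqp hp2 (by fun_prop)
    (fun z hz => Real.rpow_pos_of_pos (ha0.trans_lt hz) _) (fun z hz => ?_) (fun z hz => ?_) hx
  · have h1 := (ha2 z hz).1
    rw [show 1 + γ - (γ + 1) = 0 by ring, Real.rpow_zero, one_mul] at h1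
    have := killed_rpow_add_le (a := a) (ε := ε) (t := 1) hε0.le zero_le_one (ha2 z hz).2
      (by linarith)
    simpa using this
  · have hz0 := ha0.trans_lt hz
    simp_rw [hw]
    refine killed_rpow_add_le hε0.le (by positivity) (ha1 z hz).2 ?_
    have h1 := (ha1 z hz).1.le.trans hεr
    have e : (|(z : ℝ)| ^ (γ + 1)) ^ (p - 1) * |(z : ℝ)| ^ (1 + γ - r) = 1 := by
      rw [← Real.rpow_mul (abs_nonneg _), ← Real.rpow_add hz0, hr]
      ring_nf
      simp
    have h2 := mul_le_mul_of_nonneg_left h1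
      (show 0 ≤ (|(z : ℝ)| ^ (γ + 1)) ^ (p - 1) by positivity)
    rw [← mul_assoc, e, one_mul] at h2
    linarith

/-- From `x ≤ L`, an inward jump longer than `2 L` lands beyond `-L`; the doubling costs the factor
`2 ^ (-β)`. -/
lemma le_measure_abs_ge (hT : InwardTails P α β c x₀) {x : X} (hx0 : 0 < (x : ℝ))
    (hx : x₀ ≤ (x : ℝ)) : ∃ L₀, ∀ L, L₀ ≤ L →
      ENNReal.ofReal (c / 2 * 2 ^ (-β) * L ^ (-β)) ≤ P x {z : X | L ≤ |(z : ℝ)|} := by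
  have hc := hT.c_pos
  have hβ0 : 0 < β := by linarith [hT.one_lt_beta]
  obtain ⟨Y, hY⟩ := hT.exists_tailNeg (half_pos hc)
  refine ⟨max Y x, fun L hL => ?_⟩
  have hxL : (x : ℝ) ≤ L := (le_max_right _ _).trans hL
  have hL0 : 0 < L := hx0.trans_le hxL
  have h2L : 0 < 2 * L := by positivity
  have h1 := (abs_le.1 (hY x hx (2 * L) (by linarith [(le_max_left Y (x : ℝ)).trans hL]))).1
  have h2 : c / 2 * 2 ^ (-β) * L ^ (-β) ≤ tailNeg P x (2 * L) := by
    rw [mul_assoc, ← Real.mul_rpow (by norm_num) hL0.le, Real.rpow_neg h2L.le, ← div_eq_mul_inv,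
      div_le_iff₀ (by positivity)]
    linarith
  refine (ENNReal.ofReal_le_ofReal h2).trans ?_
  rw [tailNeg, ofReal_measureReal]
  refine measure_mono fun z hz => ?_
  have h3 := (lt_negPart_iff h2L.le).1 (mem_ofPred_eq ▸ hz)
  show L ≤ |(z : ℝ)|
  rw [le_abs]
  right
  linarith

/-- One large jump, then a long return. The start is taken with `x > a ≥ x₀` so that the lower bound
on the left-going tail applies to the first step. -/
lemma infinite_moment_subcritical (hT : InwardTails P α β c x₀) (hD : DriftAsymptotics P γ b)
    (hγ : γ < β - 1) (hb : b < 0) (hqγ : β / (γ + 1) ≤ q) :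
    ∀ᶠ a : ℝ in atTop, ∀ x : X, a < (x : ℝ) → passageMoment P q a x = ⊤ := by
  have hγ0 := hD.gamma_nonneg
  have hγ1 : 0 < γ + 1 := by linarith
  have hβ0 : 0 < β := by linarith [hT.one_lt_beta]
  have hc := hT.c_pos
  obtain ⟨r, hr, hrβ⟩ := exists_between (show γ + 1 < β by linarith)
  have hr0 : 0 < r := by linarith
  have hev1 := eventually_awayFilter (((tendsto_powerDrift_subcritical hT hD hγ hr0
    hrβ).eventually_lt_const (show r * b < 0 by nlinarith)).and
    (hT.eventually_integrable hr0 hrβ))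
  have hev2 := eventually_awayFilter (((tendsto_powerDrift_subcritical hT hD hγ hγ1
    (by linarith)).eventually_const_lt (show (γ + 1) * b - 1 < (γ + 1) * b by linarith)).and
    (hT.eventually_integrable hγ1 (by linarith)))
  filter_upwards [hev1, hev2, eventually_ge_atTop 1, eventually_ge_atTop x₀] with a ha1 ha2 ha hax
    x hx
  have ha0 : 0 < a := by linarith
  have hC : 0 < 1 - (γ + 1) * b := by nlinarith
  have h1 : ∀ z : X, a < |(z : ℝ)| → ENNReal.ofReal (|(z : ℝ)| ^ (γ + 1) - a ^ (γ + 1))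
      ≤ killed P a (fun z => ENNReal.ofReal (|(z : ℝ)| ^ (γ + 1) - a ^ (γ + 1))) z
        + ENNReal.ofReal (1 - (γ + 1) * b) := by
    intro z hz
    have h1 := (ha2 z hz).1
    rw [show 1 + γ - (γ + 1) = 0 by ring, Real.rpow_zero, one_mul] at h1
    exact rpow_sub_le_killed_add hγ1 hC.le (ha2 z hz).2 (by linarith)
  have h2 : ∀ z : X, a < |(z : ℝ)| → killed P a (fun z => ENNReal.ofReal (|(z : ℝ)| ^ r)) z
      ≤ ENNReal.ofReal (|(z : ℝ)| ^ r) := by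
    intro z hz
    have hz0 : 0 < |(z : ℝ)| := by linarith
    have h1 := (ha1 z hz).1
    have h2 : powerDrift P r z ≤ 0 := by
      by_contra hlt
      push Not at hlt
      have : 0 < |(z : ℝ)| ^ (1 + γ - r) * powerDrift P r z := by positivity
      linarith
    simpa using killed_rpow_le_add (a := a) le_rfl (ha1 z hz).2 h2
  obtain ⟨δ, hδ, δ', hδ', key⟩ := exists_le_killed_iterate_one P ha0 hC (by linarith) hr h1 h2
  obtain ⟨L₀, hL₀⟩ := le_measure_abs_ge hT (x := x) (by linarith) (by linarith)
  exact passageMoment_eq_top_of_jump P ha0 hδ hδ' hγ1 hβ0 (by positivity) hqγ key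
    (hx.trans_le (le_abs_self _)) hL₀

/-- The dichotomy at the exponent `ν / β` for a root `ν` of the critical equation. -/
lemma moment_dichotomy_critical (hT : InwardTails P α β c x₀)
    (hD : DriftAsymptotics P (β - 1) b) (hν : ν ∈ Ioo 0 β) (hb : b + c * tailDrift β ν = 0)
    (hq : 0 < q) : ∀ᶠ a : ℝ in atTop, ∀ x : X, a < (x : ℝ) →
      (q < ν / β → passageMoment P q a x < ⊤) ∧ (ν / β < q → passageMoment P q a x = ⊤) := by
  rcases lt_trichotomy q (ν / β) with h | h | h
  · filter_upwards [finite_moment_critical hT hD hν hb hq h] with a ha x hx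
    exact ⟨fun _ => ha x (hx.trans_le (le_abs_self _)), fun h' => absurd h' h.not_gt⟩
  · exact Eventually.of_forall fun a x _ => ⟨fun h' => absurd h h'.ne, fun h' => absurd h h'.ne'⟩
  · filter_upwards [infinite_moment_critical hT hD hν hb h] with a ha x hx
    exact ⟨fun h' => absurd h' h.not_gt, fun _ => ha x (hx.trans_le (le_abs_self _))⟩

end Main

end HeavyTailChain

theorem theorem2p6 (X : Set ℝ) (hX : MeasurableSet X) (hXu : ¬ Bornology.IsBounded X)
    (P : Kernel X X) [IsMarkovKernel P] (α β c x₀ γ b : ℝ)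
    (hT : HeavyTailChain.InwardTails P α β c x₀)
    (hD : HeavyTailChain.DriftAsymptotics P γ b) :
    (β - 1 < γ → 1 / 2 < β - 1 →
      ∀ q : ℝ, 0 < q → ∀ᶠ a : ℝ in atTop, ∀ x : X, a < (x : ℝ) →
        (q < (2 * β - 3) / β → HeavyTailChain.passageMoment P q a x < ⊤) ∧
        ((2 * β - 3) / β < q → HeavyTailChain.passageMoment P q a x = ⊤)) ∧
    (γ = β - 1 → b + c * Real.pi * Real.cot (Real.pi * β) < 0 →
      ∃ ν : ℝ, (ν ∈ Ioo 0 β ∧ HeavyTailChain.CriticalEq β b c ν) ∧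
        (∀ ν' : ℝ, ν' ∈ Ioo 0 β → HeavyTailChain.CriticalEq β b c ν' → ν' = ν) ∧
        ∀ q : ℝ, 0 < q → ∀ᶠ a : ℝ in atTop, ∀ x : X, a < (x : ℝ) →
          (q < ν / β → HeavyTailChain.passageMoment P q a x < ⊤) ∧
          (ν / β < q → HeavyTailChain.passageMoment P q a x = ⊤)) ∧
    (γ < β - 1 → b < 0 →
      ∀ q : ℝ, 0 < q → ∀ᶠ a : ℝ in atTop, ∀ x : X, a < (x : ℝ) →
        (q < β / (γ + 1) → HeavyTailChain.passageMoment P q a x < ⊤) ∧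
        (β / (γ + 1) ≤ q → HeavyTailChain.passageMoment P q a x = ⊤)) := by
  have hβ1 := hT.one_lt_beta
  have hβ2 := hT.beta_lt_two
  have hc := hT.c_pos
  refine ⟨fun hγ hβ q hq => ?_, fun hγ hb => ?_, fun hγ hb q hq => ?_⟩
  · refine HeavyTailChain.moment_dichotomy_critical hT (hD.of_lt (by linarith) hγ)
      ⟨by linarith, by linarith⟩ ?_ hq
    rw [HeavyTailChain.tailDrift_two_mul_sub_three (by linarith) hβ2]
    simp
  · subst hγ
    obtain ⟨ν, hν, hνb⟩ := HeavyTailChain.exists_tailDrift_eq hβ1 hβ2 hc hb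
    refine ⟨ν, ⟨hν, (HeavyTailChain.criticalEq_iff hβ1 hβ2 hc hν.1 hν.2).2 hνb⟩, fun ν' hν' h => ?_,
      fun q hq => HeavyTailChain.moment_dichotomy_critical hT hD hν hνb hq⟩
    have h' := (HeavyTailChain.criticalEq_iff hβ1 hβ2 hc hν'.1 hν'.2).1 h
    have heq : HeavyTailChain.tailDrift β ν' = HeavyTailChain.tailDrift β ν := mul_left_cancel₀ hc.ne' (by linarith)
    rcases lt_trichotomy ν' ν with h1 | h1 | h1
    · exact absurd heq (HeavyTailChain.tailDrift_strictMono hβ1 hβ2 hν'.1 h1 hν.2).ne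
    · exact h1
    · exact absurd heq (HeavyTailChain.tailDrift_strictMono hβ1 hβ2 hν.1 h1 hν'.2).ne'
  · rcases lt_or_ge q (β / (γ + 1)) with h | h
    · filter_upwards [HeavyTailChain.finite_moment_subcritical hT hD hγ hb hq h] with a ha x hx
      exact ⟨fun _ => ha x (hx.trans_le (le_abs_self _)), fun h' => absurd h h'.not_gt⟩
    · filter_upwards [HeavyTailChain.infinite_moment_subcritical hT hD hγ hb h] with a ha x hx
      exact ⟨fun h' => absurd h' h.not_gt, fun _ => ha x hx⟩
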